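/- Let $\nu,\alpha,\beta,k,\omega$ be real numbers with $\alpha-|\nu|>-1$, $\beta>-1$, $k\ge 0$, $\omega>0$. Let $H^{(1)}_\nu=J_\nu+iY_\nu$ be the Hankel function of the first kind, and let $T_n^*(x)=T_n(2x-1)$ be the shifted Chebyshev polynomial of the first kind on $[0,1]$ (with $T^*_{-n}=T^*_n$). Put $$M(n)=M(n,k,\omega)=\int_0^1 x^\alpha(1-x)^\beta T_n^*(x)e^{2ikx}H^{(1)}_\nu(\omega x)\,dx,$$ and let $\widetilde M_n^{[1]},\widetilde M_n^{[2]},\widetilde M_n^{[3]}$ be the integrals obtained by inserting into the integrand the extra factor $\ln x$, $\ln(1-x)$, $\ln x\,\ln(1-x)$, respectively. Then all these integrals converge absolutely, and for every integer $n$ $$\widetilde M_n^{[1]}=\frac{\partial}{\partial\alpha}M(n,k,\omega),\qquad \widetilde M_n^{[2]}=\frac{\partial}{\partial\beta}M(n,k,\omega),\qquad \widetilde M_n^{[3]}=\frac{\partial^2}{\partial\alpha\,\partial\beta}M(n,k,\omega)$$ (the derivatives exist, the mixed one in either order). Moreover, for $\ell=1,2,3$ and all integers $n\ge 4$, $$\begin{aligned}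 &\Big(\tfrac{\omega^2}{16}-\tfrac{k^2}{4}\Big)\widetilde M^{[\ell]}_{n+4}+f_1(n)\widetilde M^{[\ell]}_{n+3}+f_2(n)\widetilde M^{[\ell]}_{n+2}+f_3(n)\widetilde M^{[\ell]}_{n+1}+f_4(n)\widetilde M^{[\ell]}_{n}\\ &\quad+f_3(-n)\widetilde M^{[\ell]}_{n-1}+f_2(-n)\widetilde M^{[\ell]}_{n-2}+f_1(-n)\widetilde M^{[\ell]}_{n-3}+\Big(\tfrac{\omega^2}{16}-\tfrac{k^2}{4}\Big)\widetilde M^{[\ell]}_{n-4}=r_n^{[\ell]}, \end{aligned}$$ where $$\begin{aligned} f_1(n)&=ik(\alpha+\beta+n+4)-\tfrac12 ik,\\ f_2(n)&=9+6(\alpha+\beta+n)+k^2+n^2+\alpha^2+\beta^2-\tfrac14\omega^2-\nu^2+2(\alpha\beta+\alpha n+\beta n)+ik(1-2\alpha+2\beta),\\ f_3(n)&=2n-8\alpha+12\beta+4(1-i\alpha k-i\beta k+\nu^2+\beta n-\alpha n)-\tfrac{31}{2}ik+3ik(\alpha+\beta-n+4)+4(\beta^2-\alpha^2),\\ f_4(n)&=6+4\alpha+12\beta-4\alpha\beta-2ik+4ik(\alpha-\beta)+\tfrac38\omega^2-\tfrac32k^2+6(\alpha^2+\beta^2-\nu^2)-2n^2,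 \end{aligned}$$ and $$\begin{aligned} r_n^{[1]}=-\big\{&ikM(n+3)+(6+2\beta+2n+2\alpha-2ik)M(n+2)-(8+ik+4n+8\alpha)M(n+1)\\ &+(4-4\beta+4ik+12\alpha)M(n)-(8+ik-4n+8\alpha)M(n-1)\\ &+(6+2\beta-2n+2\alpha-2ik)M(n-2)+ikM(n-3)\big\},\\ r_n^{[2]}=-\big\{&ikM(n+3)+(6+2\beta+2n+2\alpha+2ik)M(n+2)+(12-ik+4n+8\beta)M(n+1)\\ &+(12-4\alpha-4ik+12\beta)M(n)+(12-ik-4n+8\beta)M(n-1)\\ &+(6+2\beta-2n+2\alpha+2ik)M(n-2)+ikM(n-3)\big\},\\ r_n^{[3]}=-\big\{&ik\big(\widetilde M^{[1]}_{n+3}+\widetilde M^{[2]}_{n+3}\big)+(6+2\beta+2n+2\alpha+2ik)\widetilde M^{[1]}_{n+2}+(6+2\beta+2n+2\alpha-2ik)\widetilde M^{[2]}_{n+2}\\ &+2M(n+2)+(12-ik+4n+8\beta)\widetilde M^{[1]}_{n+1}-(8+ik+4n+8\alpha)\widetilde M^{[2]}_{n+1}\\ &+(12-4\alpha-4ik+12\beta)\widetilde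 M^{[1]}_{n}+(4-4\beta+4ik+12\alpha)\widetilde M^{[2]}_{n}-4M(n)\\ &+(12-ik-4n+8\beta)\widetilde M^{[1]}_{n-1}-(8+ik-4n+8\alpha)\widetilde M^{[2]}_{n-1}\\ &+(6+2\beta-2n+2\alpha+2ik)\widetilde M^{[1]}_{n-2}+(6+2\beta-2n+2\alpha-2ik)\widetilde M^{[2]}_{n-2}\\ &+2M(n-2)+ik\big(\widetilde M^{[1]}_{n-3}+\widetilde M^{[2]}_{n-3}\big)\big\}. \end{aligned}$$ -/

import Mathlib

open Filter Topology

noncomputable section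

/-- Bessel function of the first kind of real order `ν` at a positive real `x`, by its power series.
At the poles of `Γ` Mathlib has `Γ = 0`, so that the corresponding terms vanish, as they should. -/
def besselJ (ν x : ℝ) : ℝ :=
  ∑' m : ℕ, (-1) ^ m / ((m.factorial : ℝ) * Real.Gamma (m + ν + 1)) * (x / 2) ^ (2 * m + ν)

/-- The quotient that gives the Bessel function of the second kind for non-integral order. -/
def besselYQuot (ν x : ℝ) : ℝ :=
  (besselJ ν x * Real.cos (ν * Real.pi) - besselJ (-ν) x) / Real.sin (ν * Real.pi)

open Classical in
/-- Bessel function of the second kind of real order; for an integral order it is the limiting value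
of the quotient. -/
def besselY (ν x : ℝ) : ℝ :=
  if ∃ m : ℤ, ν = m then limUnder (𝓝[≠] ν) (fun μ : ℝ => besselYQuot μ x) else besselYQuot ν x

/-- Hankel function of the first kind. -/
def hankelH1 (ν x : ℝ) : ℂ := besselJ ν x + Complex.I * besselY ν x

/-- Shifted Chebyshev polynomial of the first kind, as a function on `[0, 1]`. -/
def shiftedChebyshevT (n : ℤ) (x : ℝ) : ℝ := (Polynomial.Chebyshev.T ℝ n).eval (2 * x - 1)

/-- The integrand of the modified moment of index `n`. -/
def momentIntegrand (ν k ω α β : ℝ) (n : ℤ) (x : ℝ) : ℂ :=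
  ((x ^ α * (1 - x) ^ β * shiftedChebyshevT n x : ℝ) : ℂ) *
    Complex.exp (Complex.I * (2 * k * x)) * hankelH1 ν (ω * x)

/-- The modified moment `M(n, k, ω)`. -/
def moment (ν k ω α β : ℝ) (n : ℤ) : ℂ :=
  ∫ x in (0 : ℝ)..1, momentIntegrand ν k ω α β n x

/-- The moment with the extra factor `ln x`. -/
def logMoment1 (ν k ω α β : ℝ) (n : ℤ) : ℂ :=
  ∫ x in (0 : ℝ)..1, (Real.log x : ℂ) * momentIntegrand ν k ω α β n x

/-- The moment with the extra factor `ln (1 - x)`. -/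
def logMoment2 (ν k ω α β : ℝ) (n : ℤ) : ℂ :=
  ∫ x in (0 : ℝ)..1, (Real.log (1 - x) : ℂ) * momentIntegrand ν k ω α β n x

/-- The moment with the extra factor `ln x * ln (1 - x)`. -/
def logMoment3 (ν k ω α β : ℝ) (n : ℤ) : ℂ :=
  ∫ x in (0 : ℝ)..1,
    (Real.log x : ℂ) * (Real.log (1 - x) : ℂ) * momentIntegrand ν k ω α β n x

/-- `f₁(n, α, β)` -/
def recCoeff1 (k α β : ℝ) (n : ℤ) : ℂ :=
  Complex.I * k * (α + β + n + 4) - 1 / 2 * Complex.I * k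

/-- `f₂(n, α, β)` -/
def recCoeff2 (ν k ω α β : ℝ) (n : ℤ) : ℂ :=
  9 + 6 * (α + β + n) + k ^ 2 + n ^ 2 + α ^ 2 + β ^ 2 - 1 / 4 * ω ^ 2 - ν ^ 2
    + 2 * (α * β + α * n + β * n) + Complex.I * k * (1 - 2 * α + 2 * β)

/-- `f₃(n, α, β)` -/
def recCoeff3 (ν k α β : ℝ) (n : ℤ) : ℂ :=
  2 * n - 8 * α + 12 * β
    + 4 * (1 - Complex.I * α * k - Complex.I * β * k + ν ^ 2 + β * n - α * n)
    - 31 / 2 * Complex.I * k + 3 * Complex.I * k * (α + β - n + 4) + 4 * (β ^ 2 - α ^ 2)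

/-- `f₄(n, α, β)` -/
def recCoeff4 (ν k ω α β : ℝ) (n : ℤ) : ℂ :=
  6 + 4 * α + 12 * β - 4 * α * β - 2 * Complex.I * k + 4 * Complex.I * k * (α - β)
    + 3 / 8 * ω ^ 2 - 3 / 2 * k ^ 2 + 6 * (α ^ 2 + β ^ 2 - ν ^ 2) - 2 * n ^ 2

/-- The left-hand side of the nine-term recurrence at index `n`, for a sequence `S`. -/
def nineTerm (ν k ω α β : ℝ) (S : ℤ → ℂ) (n : ℤ) : ℂ :=
  (1 / 16 * ω ^ 2 - 1 / 4 * k ^ 2) * S (n + 4)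
    + recCoeff1 k α β n * S (n + 3)
    + recCoeff2 ν k ω α β n * S (n + 2)
    + recCoeff3 ν k α β n * S (n + 1)
    + recCoeff4 ν k ω α β n * S n
    + recCoeff3 ν k α β (-n) * S (n - 1)
    + recCoeff2 ν k ω α β (-n) * S (n - 2)
    + recCoeff1 k α β (-n) * S (n - 3)
    + (1 / 16 * ω ^ 2 - 1 / 4 * k ^ 2) * S (n - 4)

/-- The right-hand side for the moments with factor `ln x`, built from the sequence `M` of moments. -/
def logRhs1 (k α β : ℝ) (M : ℤ → ℂ) (n : ℤ) : ℂ :=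
  -(Complex.I * k * M (n + 3)
    + (6 + 2 * β + 2 * n + 2 * α - 2 * Complex.I * k) * M (n + 2)
    - (8 + Complex.I * k + 4 * n + 8 * α) * M (n + 1)
    + (4 - 4 * β + 4 * Complex.I * k + 12 * α) * M n
    - (8 + Complex.I * k - 4 * n + 8 * α) * M (n - 1)
    + (6 + 2 * β - 2 * n + 2 * α - 2 * Complex.I * k) * M (n - 2)
    + Complex.I * k * M (n - 3))

/-- The right-hand side for the moments with factor `ln (1 - x)`. -/
def logRhs2 (k α β : ℝ) (M : ℤ → ℂ) (n : ℤ) : ℂ :=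
  -(Complex.I * k * M (n + 3)
    + (6 + 2 * β + 2 * n + 2 * α + 2 * Complex.I * k) * M (n + 2)
    + (12 - Complex.I * k + 4 * n + 8 * β) * M (n + 1)
    + (12 - 4 * α - 4 * Complex.I * k + 12 * β) * M n
    + (12 - Complex.I * k - 4 * n + 8 * β) * M (n - 1)
    + (6 + 2 * β - 2 * n + 2 * α + 2 * Complex.I * k) * M (n - 2)
    + Complex.I * k * M (n - 3))

/-- The right-hand side for the moments with factor `ln x * ln (1 - x)`, built from the moments `M`,
the moments `M₁` with factor `ln x` and the moments `M₂` with factor `ln (1 - x)`. -/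
def logRhs3 (k α β : ℝ) (M M₁ M₂ : ℤ → ℂ) (n : ℤ) : ℂ :=
  -(Complex.I * k * (M₁ (n + 3) + M₂ (n + 3))
    + (6 + 2 * β + 2 * n + 2 * α + 2 * Complex.I * k) * M₁ (n + 2)
    + (6 + 2 * β + 2 * n + 2 * α - 2 * Complex.I * k) * M₂ (n + 2)
    + 2 * M (n + 2)
    + (12 - Complex.I * k + 4 * n + 8 * β) * M₁ (n + 1)
    - (8 + Complex.I * k + 4 * n + 8 * α) * M₂ (n + 1)
    + (12 - 4 * α - 4 * Complex.I * k + 12 * β) * M₁ n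
    + (4 - 4 * β + 4 * Complex.I * k + 12 * α) * M₂ n
    - 4 * M n
    + (12 - Complex.I * k - 4 * n + 8 * β) * M₁ (n - 1)
    - (8 + Complex.I * k - 4 * n + 8 * α) * M₂ (n - 1)
    + (6 + 2 * β - 2 * n + 2 * α + 2 * Complex.I * k) * M₁ (n - 2)
    + (6 + 2 * β - 2 * n + 2 * α - 2 * Complex.I * k) * M₂ (n - 2)
    + 2 * M (n - 2)
    + Complex.I * k * (M₁ (n - 3) + M₂ (n - 3)))

end

/-! The heart of the matter is an exact nine-term recurrence `nineTerm_moment` with zero right-hand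
side, valid for all admissible exponents; the logarithmic recurrences are its derivatives in α and
β.

For the homogeneous recurrence, put h(x) = H_ν(ωx), which is annihilated by L = x²∂² + x∂ + (ω²x² −
ν²), and φ = x^α (1−x)^(β+2) e^{2ikx} T*_n. Lagrange's identity says that h L*φ − φ Lh is the
derivative of the bilinear concomitant (x²φ)'h − x²φh' − xφh. The factor (1−x)² lets L*φ keep the
weight x^α (1−x)^β e^{2ikx}, with T*_n'' removed by the Chebyshev equation. What remains is a
combination of T*_{n−4}, …, T*_{n+4}, and 16 L*φ is exactly the integrand of the nine-term sum
(`nineTerm_shiftedChebyshevT`, `hasDerivAt_concomitant`). The integral is then a difference of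
boundary values. Both vanish: at 0 because h and xh' are O(x^(−ρ)) for some ρ with |ν| < ρ < α + 1,
at 1 because β + 1 > 0.

This needs the differential equation and the growth of H_ν for every real order
(`exists_hankelH1_solution`). Both come from the power series and the entire function 1/Γ. For
integral orders Y_ν is a combination of order derivatives of J, so the series is also differentiated
in the order.

Differentiation under the integral sign (`hasDerivAt_integral_rpow_mul`) identifies logarithmic
moments with derivatives in the exponents. The coefficients are at most quadratic in α and in β, so
the product rule applied to the recurrence produces the stated right-hand sides. -/

noncomputable section

/-! ### The reciprocal Gamma function on the real line -/

/-- The reciprocal of the real Gamma function, an entire function. -/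
def recipGamma (s : ℝ) : ℝ := (Real.Gamma s)⁻¹

theorem ofReal_recipGamma (s : ℝ) : ((recipGamma s : ℝ) : ℂ) = (Complex.Gamma s)⁻¹ := by
  rw [recipGamma, Complex.ofReal_inv, Complex.Gamma_ofReal]

theorem recipGamma_eq_self_mul (s : ℝ) : recipGamma s = s * recipGamma (s + 1) := by
  have h := Complex.one_div_Gamma_eq_self_mul_one_div_Gamma_add_one s
  rw [← ofReal_recipGamma, show (s : ℂ) + 1 = ((s + 1 : ℝ) : ℂ) by push_cast; rfl,
    ← ofReal_recipGamma] at h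
  exact_mod_cast h

theorem contDiff_recipGamma : ContDiff ℝ 2 recipGamma := by
  have h : ContDiff ℂ 2 fun s : ℂ => (Complex.Gamma s)⁻¹ :=
    Complex.differentiable_one_div_Gamma.contDiff
  have h2 := fun x : ℝ => (h.contDiffAt (x := (x : ℂ))).real_of_complex
  refine contDiff_iff_contDiffAt.2 fun x => ?_
  convert! h2 x using 1
  ext y
  rw [← ofReal_recipGamma, Complex.ofReal_re]

theorem hasDerivAt_recipGamma (s : ℝ) : HasDerivAt recipGamma (deriv recipGamma s) s :=
  (contDiff_recipGamma.differentiable (by norm_num) s).hasDerivAt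

theorem deriv_recipGamma_eq (s : ℝ) :
    deriv recipGamma s = recipGamma (s + 1) + s * deriv recipGamma (s + 1) := by
  have h1 : HasDerivAt (fun s => s * recipGamma (s + 1))
      (1 * recipGamma (s + 1) + s * deriv recipGamma (s + 1)) s :=
    (hasDerivAt_id s).mul ((hasDerivAt_recipGamma (s + 1)).comp_add_const s 1)
  have h2 : recipGamma = fun s => s * recipGamma (s + 1) := funext recipGamma_eq_self_mul
  have h3 := hasDerivAt_recipGamma s
  rw [one_mul] at h1
  exact (h2 ▸ h3 : HasDerivAt (fun s => s * recipGamma (s + 1)) _ s).unique h1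

/-- A function that is bounded on every half line `[a, ∞)`. -/
def BddOnRays (g : ℝ → ℝ) : Prop := ∀ a, ∃ C, ∀ s, a ≤ s → |g s| ≤ C

/-- The functional equation 1/Γ(s−1) = (s−1)/Γ(s) and its derivative propagate bounds to the right
in unit steps: once s − 1 ≥ 2, dividing by s − 1 at least halves the right side. Compactness starts
the induction. -/
theorem bddOnRays_recipGamma : BddOnRays recipGamma ∧ BddOnRays (deriv recipGamma) := by
  have key : ∀ a, ∃ C, ∀ s, a ≤ s → |recipGamma s| ≤ C ∧ |deriv recipGamma s| ≤ 2 * C := by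
    intro a
    have hc1 : Continuous recipGamma := contDiff_recipGamma.continuous
    have hc2 : Continuous (deriv recipGamma) := contDiff_recipGamma.continuous_deriv (by norm_num)
    -- The interval reaches one unit beyond `max a 2`, so that for s to the right of it s − 1 is
    -- still at least a and at least 2.
    obtain ⟨C1, hC1⟩ := (isCompact_Icc (a := a) (b := max a 2 + 1)).exists_bound_of_continuousOn
      hc1.continuousOn
    obtain ⟨C2, hC2⟩ := (isCompact_Icc (a := a) (b := max a 2 + 1)).exists_bound_of_continuousOn
      hc2.continuousOn
    set C := max (max C1 C2) 0 with hC
    have hC0 : 0 ≤ C := le_max_right _ _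
    have h1C : C1 ≤ C := (le_max_left _ _).trans (le_max_left _ _)
    have h2C : C2 ≤ C := (le_max_right _ _).trans (le_max_left _ _)
    refine ⟨C, ?_⟩
    have step : ∀ N : ℕ, ∀ s, a ≤ s → s ≤ max a 2 + 1 + N →
        |recipGamma s| ≤ C ∧ |deriv recipGamma s| ≤ 2 * C := by
      intro N
      induction N with
      | zero =>
        intro s hs hs2
        rw [Nat.cast_zero, add_zero] at hs2
        have e1 := hC1 s ⟨hs, hs2⟩
        have e2 := hC2 s ⟨hs, hs2⟩
        rw [Real.norm_eq_abs] at e1 e2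
        exact ⟨e1.trans h1C, by linarith⟩
      | succ N ih =>
        intro s hs hs2
        push_cast at hs2
        by_cases hle : s ≤ max a 2 + 1 + N
        · exact ih s hs hle
        push Not at hle
        have hN : (0 : ℝ) ≤ N := N.cast_nonneg
        have ha2 : a ≤ max a 2 := le_max_left _ _
        have h22 : 2 ≤ max a 2 := le_max_right _ _
        obtain ⟨i1, i2⟩ := ih (s - 1) (by linarith) (by linarith)
        have r1 := recipGamma_eq_self_mul (s - 1)
        have r2 := deriv_recipGamma_eq (s - 1)
        rw [sub_add_cancel] at r1 r2
        have hs1 : 2 ≤ s - 1 := by linarith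
        have b1 : 2 * |recipGamma s| ≤ C := by
          calc 2 * |recipGamma s| ≤ |s - 1| * |recipGamma s| := by
                gcongr; exact hs1.trans (le_abs_self _)
            _ = |recipGamma (s - 1)| := by rw [r1, abs_mul]
            _ ≤ C := i1
        have b1' : |recipGamma s| ≤ C := by linarith [abs_nonneg (recipGamma s)]
        refine ⟨b1', ?_⟩
        have b2 : 2 * |deriv recipGamma s| ≤ 2 * C + C := by
          calc 2 * |deriv recipGamma s| ≤ |s - 1| * |deriv recipGamma s| := by
                gcongr; exact hs1.trans (le_abs_self _)
            _ = |deriv recipGamma (s - 1) - recipGamma s| := by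
                rw [r2, ← abs_mul]; congr 1; ring
            _ ≤ |deriv recipGamma (s - 1)| + |recipGamma s| := abs_sub _ _
            _ ≤ _ := add_le_add i2 b1'
        linarith
    intro s hs
    obtain ⟨N, hN⟩ := exists_nat_ge (s - (max a 2 + 1))
    exact step N s hs (by linarith)
  exact ⟨fun a => (key a).imp fun C h s hs => (h s hs).1,
    fun a => (key a).elim fun C h => ⟨2 * C, fun s hs => (h s hs).2⟩⟩

/-! ### The power series behind the Bessel functions -/

/-- The series `∑ (-t)^m / m! g(m + μ + 1)`. -/
def besselSeries (g : ℝ → ℝ) (μ t : ℝ) : ℝ :=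
  ∑' m : ℕ, (-t) ^ m / (m.factorial : ℝ) * g (m + μ + 1)

theorem summable_besselSeries {g : ℝ → ℝ} (hg : BddOnRays g) (μ t : ℝ) :
    Summable fun m : ℕ => (-t) ^ m / (m.factorial : ℝ) * g (m + μ + 1) := by
  obtain ⟨C, hC⟩ := hg (μ + 1)
  refine Summable.of_norm_bounded ((Real.summable_pow_div_factorial |t|).mul_right C) fun m => ?_
  rw [norm_mul, norm_div, norm_pow, norm_neg, Real.norm_eq_abs, Real.norm_eq_abs, Real.norm_eq_abs,
    Nat.abs_cast]
  gcongr
  exact hC _ (by linarith [(m.cast_nonneg : (0 : ℝ) ≤ m)])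

/-- Since m/m! = 1/(m−1)!, this is an index shift; the truncated exponent at m = 0 is harmless
because of the factor m. It serves both the derivative in t and the contiguous relation. -/
theorem tsum_mul_besselSeries {g : ℝ → ℝ} (hg : BddOnRays g) (μ t : ℝ) :
    HasSum (fun m : ℕ => m * (-t) ^ (m - 1) / (m.factorial : ℝ) * g (m + μ + 1))
      (besselSeries g (μ + 1) t) := by
  have h := (summable_besselSeries hg (μ + 1) t).hasSum
  rw [← hasSum_nat_add_iff' 1]
  simp only [Finset.range_one, Finset.sum_singleton, Nat.cast_zero, zero_mul, zero_div, sub_zero]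
  convert! h using 1
  ext m
  rw [Nat.factorial_succ, Nat.add_sub_cancel]
  push_cast
  rw [show (m : ℝ) + 1 + μ + 1 = m + (μ + 1) + 1 by ring]
  have : (m : ℝ) + 1 ≠ 0 := by positivity
  field_simp

theorem hasDerivAt_besselSeries {g : ℝ → ℝ} (hg : BddOnRays g) (μ t : ℝ) :
    HasDerivAt (besselSeries g μ) (-besselSeries g (μ + 1) t) t := by
  obtain ⟨C, hC⟩ := hg (μ + 1)
  have hC' : ∀ m : ℕ, |g (m + μ + 1)| ≤ C := fun m =>
    hC _ (by linarith [(m.cast_nonneg : (0 : ℝ) ≤ m)])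
  -- Termwise differentiation needs a summable majorant on an open set containing t; the ball of
  -- radius R supplies it.
  set R := |t| + 1
  have hu : Summable fun m : ℕ => m * R ^ (m - 1) / (m.factorial : ℝ) * C := by
    refine Summable.mul_right C ?_
    rw [← summable_nat_add_iff 1]
    convert! Real.summable_pow_div_factorial R using 1
    ext m
    rw [Nat.factorial_succ, Nat.add_sub_cancel]
    push_cast
    have : (m : ℝ) + 1 ≠ 0 := by positivity
    field_simp
  have key := hasDerivAt_tsum_of_isPreconnected (𝕜 := ℝ) (F := ℝ) (t := Metric.ball 0 R) (y₀ := t)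
    (y := t) (g := fun (m : ℕ) t => (-t) ^ m / (m.factorial : ℝ) * g (m + μ + 1))
    (g' := fun (m : ℕ) t => -(m * (-t) ^ (m - 1) / (m.factorial : ℝ) * g (m + μ + 1)))
    hu Metric.isOpen_ball (convex_ball _ _).isPreconnected ?_ ?_ ?_
    (summable_besselSeries hg μ t) ?_
  · rw [tsum_neg, (tsum_mul_besselSeries hg μ t).tsum_eq] at key
    exact key
  · intro m y _
    have := (((hasDerivAt_id y).neg.pow m).div_const (m.factorial : ℝ)).mul_const (g (m + μ + 1))
    convert! this using 1
    simp
    ring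
  · intro m y hy
    rw [mem_ball_zero_iff, Real.norm_eq_abs] at hy
    rw [norm_neg, norm_mul, norm_div, norm_mul, norm_pow, norm_neg, Real.norm_eq_abs,
      Real.norm_eq_abs, Real.norm_eq_abs, Real.norm_eq_abs, Nat.abs_cast, Nat.abs_cast]
    gcongr
    exact hC' m
  · simp [R]
  · simp [R]

theorem hasDerivAt_besselSeries_order {g g' : ℝ → ℝ} (hg : BddOnRays g) (hg' : BddOnRays g')
    (hd : ∀ s, HasDerivAt g (g' s) s) (μ t : ℝ) :
    HasDerivAt (fun μ => besselSeries g μ t) (besselSeries g' μ t) μ := by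
  -- A bound on a ray controls all orders above μ − 1 at once, so a half line serves as the
  -- neighbourhood of μ.
  obtain ⟨C, hC⟩ := hg' (μ - 1 + 1)
  refine hasDerivAt_tsum_of_isPreconnected (𝕜 := ℝ) (F := ℝ) (t := Set.Ioi (μ - 1)) (y₀ := μ)
    (y := μ) (g := fun (m : ℕ) μ => (-t) ^ m / (m.factorial : ℝ) * g (m + μ + 1))
    (g' := fun (m : ℕ) μ => (-t) ^ m / (m.factorial : ℝ) * g' (m + μ + 1))
    ((Real.summable_pow_div_factorial |t|).mul_right C) isOpen_Ioi isPreconnected_Ioi ?_ ?_ ?_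
    (summable_besselSeries hg μ t) ?_
  · intro m y _
    refine HasDerivAt.const_mul _ ?_
    have := (hd (m + y + 1)).comp y (((hasDerivAt_id y).const_add (m : ℝ)).add_const 1)
    simpa [Function.comp_def] using this
  · intro m y hy
    rw [norm_mul, norm_div, norm_pow, norm_neg, Real.norm_eq_abs, Real.norm_eq_abs,
      Real.norm_eq_abs, Nat.abs_cast]
    gcongr
    exact hC _ (by linarith [(m.cast_nonneg : (0 : ℝ) ≤ m), Set.mem_Ioi.1 hy])
  · simp
  · simp

theorem continuous_besselSeries {g : ℝ → ℝ} (hg : BddOnRays g) (μ : ℝ) :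
    Continuous (besselSeries g μ) :=
  continuous_iff_continuousAt.2 fun t => (hasDerivAt_besselSeries hg μ t).continuousAt

/-- Split 1/Γ(m+μ) = (m+μ)/Γ(m+μ+1): the part with μ returns the series itself, the part with m is
the index shift above. -/
theorem besselSeries_recipGamma_sub_one (μ t : ℝ) :
    besselSeries recipGamma (μ - 1) t
      = μ * besselSeries recipGamma μ t - t * besselSeries recipGamma (μ + 1) t := by
  have h1 := ((summable_besselSeries bddOnRays_recipGamma.1 μ t).hasSum).mul_left μ
  have h2 := (tsum_mul_besselSeries bddOnRays_recipGamma.1 μ t).mul_left t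
  refine HasSum.tsum_eq ?_
  convert! h1.sub h2 using 1
  ext m
  rw [show (m : ℝ) + (μ - 1) + 1 = m + μ by ring, recipGamma_eq_self_mul (m + μ)]
  rcases m with _ | m
  · simp
  · rw [Nat.add_sub_cancel, pow_succ]
    ring

/-- Both sides of the preceding relation are differentiated in the order and compared by uniqueness
of the derivative. -/
theorem besselSeries_deriv_recipGamma_sub_one (μ t : ℝ) :
    besselSeries (deriv recipGamma) (μ - 1) t
      = besselSeries recipGamma μ t + μ * besselSeries (deriv recipGamma) μ t
        - t * besselSeries (deriv recipGamma) (μ + 1) t := by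
  have hd := hasDerivAt_besselSeries_order bddOnRays_recipGamma.1 bddOnRays_recipGamma.2
    hasDerivAt_recipGamma
  have h1 : HasDerivAt (fun μ => besselSeries recipGamma (μ - 1) t)
      (besselSeries (deriv recipGamma) (μ - 1) t) μ := (hd (μ - 1) t).comp_sub_const μ 1
  have h2 := ((hasDerivAt_id μ).mul (hd μ t)).sub (((hd (μ + 1) t).comp_add_const μ 1).const_mul t)
  rw [funext fun μ => besselSeries_recipGamma_sub_one μ t] at h1
  simpa using h1.unique h2

/-- The contiguous relations at the orders −(n+1) and n+1 turn into each other, which carries the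
reflection from n and n+1 to n+2. -/
theorem besselSeries_recipGamma_neg_natCast (n : ℕ) (t : ℝ) :
    besselSeries recipGamma (-n) t = (-t) ^ n * besselSeries recipGamma n t := by
  induction n using Nat.twoStepInduction with
  | zero => simp
  | one =>
    have := besselSeries_recipGamma_sub_one 0 t
    simpa using this
  | more n ih1 ih2 =>
    have e1 := besselSeries_recipGamma_sub_one (-(n + 1 : ℕ)) t
    have e2 := besselSeries_recipGamma_sub_one (n + 1 : ℕ) t
    push_cast at *
    rw [show -((n : ℝ) + 1) - 1 = -(n + 2) by ring, ih2,
      show -((n : ℝ) + 1) + 1 = -n by ring, ih1] at e1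
    rw [show (n : ℝ) + 1 - 1 = n by ring, show (n : ℝ) + 1 + 1 = n + 2 by ring] at e2
    rw [e1, e2]
    ring

/-! ### Bessel functions and their derivatives with respect to the order -/

theorem besselJ_eq {x : ℝ} (hx : 0 < x) (μ : ℝ) :
    besselJ μ x = (x / 2) ^ μ * besselSeries recipGamma μ ((x / 2) ^ 2) := by
  rw [besselJ, besselSeries, ← tsum_mul_left]
  congr 1
  ext m
  have h : (x / 2) ^ (2 * (m : ℝ) + μ) = (x / 2) ^ μ * ((x / 2) ^ 2) ^ m := by
    rw [add_comm, Real.rpow_add (by positivity), ← pow_mul, ← Real.rpow_natCast]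
    push_cast
    rfl
  rw [h, recipGamma, neg_pow ((x / 2) ^ 2)]
  field_simp

/-- The derivative of `besselJ μ x` with respect to the order `μ`. -/
def besselJOrderDeriv (μ x : ℝ) : ℝ :=
  (x / 2) ^ μ * (Real.log (x / 2) * besselSeries recipGamma μ ((x / 2) ^ 2)
    + besselSeries (deriv recipGamma) μ ((x / 2) ^ 2))

theorem hasDerivAt_besselJ_order {x : ℝ} (hx : 0 < x) (μ : ℝ) :
    HasDerivAt (fun μ => besselJ μ x) (besselJOrderDeriv μ x) μ := by
  have h1 : HasDerivAt (fun μ : ℝ => (x / 2) ^ μ) ((x / 2) ^ μ * Real.log (x / 2)) μ :=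
    (Real.hasStrictDerivAt_const_rpow (by positivity) μ).hasDerivAt
  have h2 := hasDerivAt_besselSeries_order bddOnRays_recipGamma.1 bddOnRays_recipGamma.2
    hasDerivAt_recipGamma μ ((x / 2) ^ 2)
  rw [funext fun μ => besselJ_eq hx μ]
  convert! h1.mul h2 using 1
  rw [besselJOrderDeriv]
  ring

theorem hasDerivAt_half_rpow {x : ℝ} (hx : 0 < x) (μ : ℝ) :
    HasDerivAt (fun x : ℝ => (x / 2) ^ μ) (μ / x * (x / 2) ^ μ) x := by
  have h := ((hasDerivAt_id x).div_const 2).rpow_const (p := μ) (Or.inl (by simp; positivity))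
  convert! h using 1
  simp only [id]
  rw [Real.rpow_sub_one (by positivity)]
  field_simp

theorem hasDerivAt_besselSeries_half_sq {g : ℝ → ℝ} (hg : BddOnRays g) (μ x : ℝ) :
    HasDerivAt (fun x => besselSeries g μ ((x / 2) ^ 2))
      (-(x / 2 * besselSeries g (μ + 1) ((x / 2) ^ 2))) x := by
  have h := (hasDerivAt_besselSeries hg μ ((x / 2) ^ 2)).comp x
    (((hasDerivAt_id x).div_const 2).pow 2)
  convert! h using 1
  simp
  ring

theorem hasDerivAt_besselJ {x : ℝ} (hx : 0 < x) (μ : ℝ) :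
    HasDerivAt (besselJ μ) (μ / x * besselJ μ x - besselJ (μ + 1) x) x := by
  have h := (hasDerivAt_half_rpow hx μ).mul
    (hasDerivAt_besselSeries_half_sq bddOnRays_recipGamma.1 μ x)
  have e : besselJ μ =ᶠ[𝓝 x] fun x => (x / 2) ^ μ * besselSeries recipGamma μ ((x / 2) ^ 2) := by
    filter_upwards [lt_mem_nhds hx] with y hy using besselJ_eq hy μ
  refine (HasDerivAt.congr_of_eventuallyEq ?_ e)
  convert! h using 1
  rw [besselJ_eq hx, besselJ_eq hx, Real.rpow_add_one (by positivity)]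
  ring

theorem besselJ_sub_one {x : ℝ} (hx : 0 < x) (μ : ℝ) :
    besselJ (μ - 1) x = 2 * μ / x * besselJ μ x - besselJ (μ + 1) x := by
  rw [besselJ_eq hx, besselJ_eq hx, besselJ_eq hx, besselSeries_recipGamma_sub_one,
    Real.rpow_add_one (by positivity), Real.rpow_sub_one (by positivity)]
  field_simp

/-- With `hasDerivAt_besselJ` this makes (J_μ, J_{μ+1}) a closed first-order system, from which
Bessel's equation follows by algebra. -/
theorem hasDerivAt_besselJ_add_one {x : ℝ} (hx : 0 < x) (μ : ℝ) :
    HasDerivAt (besselJ (μ + 1)) (besselJ μ x - (μ + 1) / x * besselJ (μ + 1) x) x := by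
  convert! hasDerivAt_besselJ hx (μ + 1) using 1
  have := besselJ_sub_one hx (μ + 1)
  rw [add_sub_cancel_right] at this
  rw [this]
  ring

theorem hasDerivAt_besselJOrderDeriv {x : ℝ} (hx : 0 < x) (μ : ℝ) :
    HasDerivAt (besselJOrderDeriv μ)
      (besselJ μ x / x + μ / x * besselJOrderDeriv μ x - besselJOrderDeriv (μ + 1) x) x := by
  have hl : HasDerivAt (fun x : ℝ => Real.log (x / 2)) (1 / x) x := by
    convert! ((hasDerivAt_id x).div_const 2).log (by simp; positivity) using 1
    simp only [id]
    field_simp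
  have h := (hasDerivAt_half_rpow hx μ).mul
    ((hl.mul (hasDerivAt_besselSeries_half_sq bddOnRays_recipGamma.1 μ x)).add
      (hasDerivAt_besselSeries_half_sq bddOnRays_recipGamma.2 μ x))
  convert! h using 1
  rw [besselJ_eq hx, besselJOrderDeriv, besselJOrderDeriv, Real.rpow_add_one (by positivity)]
  simp only [Pi.mul_apply, Pi.add_apply]
  ring

theorem besselJOrderDeriv_sub_one {x : ℝ} (hx : 0 < x) (μ : ℝ) :
    besselJOrderDeriv (μ - 1) x
      = 2 / x * besselJ μ x + 2 * μ / x * besselJOrderDeriv μ x - besselJOrderDeriv (μ + 1) x := by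
  rw [besselJ_eq hx, besselJOrderDeriv, besselJOrderDeriv, besselJOrderDeriv,
    besselSeries_recipGamma_sub_one, besselSeries_deriv_recipGamma_sub_one,
    Real.rpow_add_one (by positivity), Real.rpow_sub_one (by positivity)]
  field_simp
  ring

theorem hasDerivAt_besselJOrderDeriv_add_one {x : ℝ} (hx : 0 < x) (μ : ℝ) :
    HasDerivAt (besselJOrderDeriv (μ + 1))
      (besselJOrderDeriv μ x - besselJ (μ + 1) x / x
        - (μ + 1) / x * besselJOrderDeriv (μ + 1) x) x := by
  convert! hasDerivAt_besselJOrderDeriv hx (μ + 1) using 1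
  have := besselJOrderDeriv_sub_one hx (μ + 1)
  rw [add_sub_cancel_right] at this
  rw [this]
  ring

theorem besselJ_neg_natCast {x : ℝ} (hx : 0 < x) (n : ℕ) :
    besselJ (-n) x = (-1) ^ n * besselJ n x := by
  rw [besselJ_eq hx, besselJ_eq hx, besselSeries_recipGamma_neg_natCast, neg_pow,
    Real.rpow_neg (by positivity), Real.rpow_natCast, ← pow_mul, mul_comm 2 n, pow_mul]
  have ha : (x / 2) ^ n ≠ 0 := by positivity
  field_simp

theorem besselJ_neg_intCast {x : ℝ} (hx : 0 < x) (n : ℤ) :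
    besselJ (-n) x = (-1) ^ n * besselJ n x := by
  obtain ⟨m, rfl | rfl⟩ := n.eq_nat_or_neg
  · simpa using besselJ_neg_natCast hx m
  · have h := besselJ_neg_natCast hx m
    have h1 : ((-1 : ℝ) ^ m) * (-1) ^ m = 1 := by rw [← mul_pow]; simp
    push_cast
    rw [neg_neg, h, zpow_neg, zpow_natCast, ← inv_pow, ← mul_assoc]
    norm_num
    rw [h1, one_mul]

/-! ### Growth at the origin -/

theorem half_rpow_isBigO {ρ μ : ℝ} (h : -ρ ≤ μ) :
    (fun x : ℝ => (x / 2) ^ μ) =O[𝓝[>] 0] fun x => x ^ (-ρ) := by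
  refine Asymptotics.IsBigO.of_bound ((1 / 2) ^ μ) ?_
  filter_upwards [Ioc_mem_nhdsGT (zero_lt_one' ℝ)] with x hx
  rw [Real.norm_eq_abs, Real.norm_eq_abs, abs_of_pos (Real.rpow_pos_of_pos hx.1 _),
    abs_of_pos (Real.rpow_pos_of_pos (half_pos hx.1) _), div_eq_mul_one_div,
    Real.mul_rpow hx.1.le (by norm_num), mul_comm]
  gcongr ?_ * ?_
  exact Real.rpow_le_rpow_of_exponent_ge hx.1 hx.2 h

/-- The logarithm is absorbed by an arbitrarily small power; hence the strict inequality here and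
|ν| < ρ later. -/
theorem half_rpow_mul_log_isBigO {ρ μ : ℝ} (h : -ρ < μ) :
    (fun x : ℝ => (x / 2) ^ μ * Real.log (x / 2)) =O[𝓝[>] 0] fun x => x ^ (-ρ) := by
  have h0 : Tendsto (fun x : ℝ => Real.log x * x ^ (μ + ρ)) (𝓝[>] 0) (𝓝 0) :=
    tendsto_log_mul_rpow_nhdsGT_zero (by linarith)
  have ht : Tendsto (fun x : ℝ => x / 2) (𝓝[>] 0) (𝓝[>] 0) := by
    refine tendsto_nhdsWithin_of_tendsto_nhds_of_eventually_within _ ?_ ?_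
    · have : Tendsto (fun x : ℝ => x / 2) (𝓝 0) (𝓝 (0 / 2)) := tendsto_id.div_const 2
      rw [zero_div] at this
      exact this.mono_left nhdsWithin_le_nhds
    · filter_upwards [self_mem_nhdsWithin] with x hx using half_pos (Set.mem_Ioi.1 hx)
  have h1 := ((h0.comp ht).isBigO_one ℝ).mul (half_rpow_isBigO (le_refl (-ρ)))
  simp only [one_mul] at h1
  refine h1.congr' ?_ EventuallyEq.rfl
  filter_upwards [self_mem_nhdsWithin] with x hx
  rw [Function.comp, mul_assoc, ← Real.rpow_add (half_pos (Set.mem_Ioi.1 hx)),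
    add_neg_cancel_right, mul_comm]

theorem continuous_isBigO_one_nhdsGT {f : ℝ → ℝ} (hf : Continuous f) (a : ℝ) :
    f =O[𝓝[>] a] fun _ => (1 : ℝ) :=
  ((hf.tendsto a).isBigO_one ℝ).mono nhdsWithin_le_nhds

theorem besselJ_isBigO {ρ μ : ℝ} (h : -ρ ≤ μ) : besselJ μ =O[𝓝[>] 0] fun x => x ^ (-ρ) := by
  have hc : Continuous fun x : ℝ => besselSeries recipGamma μ ((x / 2) ^ 2) :=
    (continuous_besselSeries bddOnRays_recipGamma.1 μ).comp (by fun_prop)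
  have := (half_rpow_isBigO h).mul (continuous_isBigO_one_nhdsGT hc 0)
  simp only [mul_one] at this
  refine this.congr' ?_ EventuallyEq.rfl
  filter_upwards [self_mem_nhdsWithin] with x hx using (besselJ_eq hx μ).symm

theorem besselJOrderDeriv_isBigO {ρ μ : ℝ} (h : -ρ < μ) :
    besselJOrderDeriv μ =O[𝓝[>] 0] fun x => x ^ (-ρ) := by
  have hc : Continuous fun x : ℝ => besselSeries recipGamma μ ((x / 2) ^ 2) :=
    (continuous_besselSeries bddOnRays_recipGamma.1 μ).comp (by fun_prop)
  have hc' : Continuous fun x : ℝ => besselSeries (deriv recipGamma) μ ((x / 2) ^ 2) :=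
    (continuous_besselSeries bddOnRays_recipGamma.2 μ).comp (by fun_prop)
  have := ((half_rpow_mul_log_isBigO h).mul (continuous_isBigO_one_nhdsGT hc 0)).add
    ((half_rpow_isBigO h.le).mul (continuous_isBigO_one_nhdsGT hc' 0))
  simp only [mul_one] at this
  refine this.congr_left fun x => ?_
  rw [besselJOrderDeriv]
  ring

/-! ### Solutions of the (inhomogeneous) Bessel equation -/

/-- `y` is a solution on `(0, ∞)`, with derivative `y'`, of the Bessel equation of order `ν` with
inhomogeneity `s`, such that `y` and `x * y'` are `O(x ^ (-ρ))` at the origin. -/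
structure IsBesselSolution (ν ρ : ℝ) (s y y' : ℝ → ℝ) : Prop where
  hasDerivAt : ∀ x, 0 < x → HasDerivAt y (y' x) x
  hasDerivAt_deriv : ∀ x, 0 < x →
    HasDerivAt y' (-(y' x) / x - (1 - ν ^ 2 / x ^ 2) * y x + s x) x
  isBigO : y =O[𝓝[>] 0] fun x => x ^ (-ρ)
  isBigO_deriv : (fun x => x * y' x) =O[𝓝[>] 0] fun x => x ^ (-ρ)

namespace IsBesselSolution

variable {ν ρ : ℝ} {s s₁ y y' z z' : ℝ → ℝ}

theorem add (h : IsBesselSolution ν ρ s y y') (h₁ : IsBesselSolution ν ρ s₁ z z') :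
    IsBesselSolution ν ρ (fun x => s x + s₁ x) (fun x => y x + z x) (fun x => y' x + z' x) where
  hasDerivAt x hx := (h.hasDerivAt x hx).add (h₁.hasDerivAt x hx)
  hasDerivAt_deriv x hx := by
    convert! (h.hasDerivAt_deriv x hx).add (h₁.hasDerivAt_deriv x hx) using 1
    ring
  isBigO := h.isBigO.add h₁.isBigO
  isBigO_deriv := (h.isBigO_deriv.add h₁.isBigO_deriv).congr_left fun x => by ring

theorem const_mul (h : IsBesselSolution ν ρ s y y') (c : ℝ) :
    IsBesselSolution ν ρ (fun x => c * s x) (fun x => c * y x) (fun x => c * y' x) where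
  hasDerivAt x hx := (h.hasDerivAt x hx).const_mul c
  hasDerivAt_deriv x hx := by
    convert! (h.hasDerivAt_deriv x hx).const_mul c using 1
    ring
  isBigO := h.isBigO.const_mul_left c
  isBigO_deriv := (h.isBigO_deriv.const_mul_left c).congr_left fun x => by ring

theorem congr (h : IsBesselSolution ν ρ s y y') (hs : ∀ x, 0 < x → s x = s₁ x)
    (hy : ∀ x, 0 < x → z x = y x) : IsBesselSolution ν ρ s₁ z y' where
  hasDerivAt x hx := (h.hasDerivAt x hx).congr_of_eventuallyEq
    (by filter_upwards [lt_mem_nhds hx] with t ht using hy t ht)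
  hasDerivAt_deriv x hx := by
    rw [← hs x hx, hy x hx]
    exact h.hasDerivAt_deriv x hx
  isBigO := h.isBigO.congr'
    (by filter_upwards [self_mem_nhdsWithin] with x hx using (hy x hx).symm) EventuallyEq.rfl
  isBigO_deriv := h.isBigO_deriv

end IsBesselSolution

theorem mul_isBigO_nhdsGT {f g : ℝ → ℝ} (hf : f =O[𝓝[>] 0] g) :
    (fun x => x * f x) =O[𝓝[>] 0] g := by
  simpa using (continuous_isBigO_one_nhdsGT continuous_id 0).mul hf

theorem isBesselSolution_besselJ {ν ρ μ : ℝ} (h : μ ^ 2 = ν ^ 2) (hρ : -ρ < μ) :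
    IsBesselSolution ν ρ (fun _ => 0) (besselJ μ)
      (fun x => μ / x * besselJ μ x - besselJ (μ + 1) x) where
  hasDerivAt x hx := hasDerivAt_besselJ hx μ
  hasDerivAt_deriv x hx := by
    have h1 : HasDerivAt (fun x : ℝ => μ / x) (-μ / x ^ 2) x := by
      convert! (hasDerivAt_const x μ).div (hasDerivAt_id x) hx.ne' using 1
      simp
    convert! (h1.mul (hasDerivAt_besselJ hx μ)).sub (hasDerivAt_besselJ_add_one hx μ) using 1
    rw [← h]
    field_simp
    ring
  isBigO := besselJ_isBigO hρ.le
  isBigO_deriv := by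
    refine (((besselJ_isBigO hρ.le).const_mul_left μ).sub
      (mul_isBigO_nhdsGT (besselJ_isBigO (μ := μ + 1) (by linarith)))).congr' ?_ EventuallyEq.rfl
    filter_upwards [self_mem_nhdsWithin] with x hx
    have := (Set.mem_Ioi.1 hx).ne'
    field_simp

/-- The inhomogeneity is what differentiating the term μ²/x² of Bessel's equation in μ leaves
behind. -/
theorem isBesselSolution_besselJOrderDeriv {ν ρ μ : ℝ} (h : μ ^ 2 = ν ^ 2) (hρ : -ρ < μ) :
    IsBesselSolution ν ρ (fun x => 2 * μ * besselJ μ x / x ^ 2) (besselJOrderDeriv μ)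
      (fun x => besselJ μ x / x + μ / x * besselJOrderDeriv μ x - besselJOrderDeriv (μ + 1) x) where
  hasDerivAt x hx := hasDerivAt_besselJOrderDeriv hx μ
  hasDerivAt_deriv x hx := by
    have h1 : HasDerivAt (fun x : ℝ => μ / x) (-μ / x ^ 2) x := by
      convert! (hasDerivAt_const x μ).div (hasDerivAt_id x) hx.ne' using 1
      simp
    convert! (((hasDerivAt_besselJ hx μ).div (hasDerivAt_id x) hx.ne').add
      (h1.mul (hasDerivAt_besselJOrderDeriv hx μ))).sub
      (hasDerivAt_besselJOrderDeriv_add_one hx μ) using 1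
    rw [← h]
    simp only [id]
    field_simp
    ring
  isBigO := besselJOrderDeriv_isBigO hρ
  isBigO_deriv := by
    refine (((besselJ_isBigO hρ.le).add ((besselJOrderDeriv_isBigO hρ).const_mul_left μ)).sub
      (mul_isBigO_nhdsGT (besselJOrderDeriv_isBigO (μ := μ + 1) (by linarith)))).congr' ?_
      EventuallyEq.rfl
    filter_upwards [self_mem_nhdsWithin] with x hx
    have := (Set.mem_Ioi.1 hx).ne'
    field_simp

/-- L'Hôpital's rule in the order: numerator and denominator of the quotient vanish at n, so it is a
quotient of slopes and tends to the quotient of derivatives. -/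
theorem besselY_intCast {x : ℝ} (hx : 0 < x) (n : ℤ) :
    besselY n x
      = 1 / Real.pi * (besselJOrderDeriv n x + (-1) ^ n * besselJOrderDeriv (-n) x) := by
  have hs2 : ((-1 : ℝ) ^ n) * (-1) ^ n = 1 := by rw [← mul_zpow]; simp
  have hs0 : ((-1 : ℝ) ^ n) ≠ 0 := left_ne_zero_of_mul_eq_one hs2
  have hcos : Real.cos (n * Real.pi) = (-1) ^ n := Real.cos_int_mul_pi n
  have hsin : Real.sin (n * Real.pi) = 0 := Real.sin_int_mul_pi n
  have hpi := Real.pi_pos.ne'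
  have hlin : HasDerivAt (fun μ : ℝ => μ * Real.pi) Real.pi (n : ℝ) := by
    simpa using (hasDerivAt_id (n : ℝ)).mul_const Real.pi
  have hN : HasDerivAt (fun μ => besselJ μ x * Real.cos (μ * Real.pi) - besselJ (-μ) x)
      (besselJOrderDeriv n x * (-1) ^ n + besselJOrderDeriv (-n) x) (n : ℝ) := by
    have h1 := ((hasDerivAt_besselJ_order hx n).mul hlin.cos).sub
      ((hasDerivAt_besselJ_order hx (-n)).comp (n : ℝ) (hasDerivAt_neg (n : ℝ)))
    convert! h1 using 1
    rw [hcos, hsin]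
    ring
  have hS : HasDerivAt (fun μ => Real.sin (μ * Real.pi)) ((-1) ^ n * Real.pi) (n : ℝ) := by
    simpa [hcos] using hlin.sin
  have hlim := (hasDerivAt_iff_tendsto_slope.1 hN).div (hasDerivAt_iff_tendsto_slope.1 hS)
    (mul_ne_zero hs0 hpi)
  rw [besselY, if_pos ⟨n, rfl⟩]
  refine Tendsto.limUnder_eq ?_
  convert! hlim.congr' ?_ using 2
  · field_simp
    linear_combination (besselJOrderDeriv (-n) x) * hs2
  · filter_upwards [self_mem_nhdsWithin] with μ hμ
    have hne : μ - n ≠ 0 := sub_ne_zero.2 hμ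
    simp only [slope, vsub_eq_sub, smul_eq_mul, Pi.div_apply]
    rw [hcos, hsin, besselJ_neg_intCast hx, besselYQuot, mul_comm (besselJ n x), sub_self, sub_zero,
      sub_zero, mul_div_mul_left _ _ (inv_ne_zero hne)]

/-- For integral ν = n the two order derivatives have sources proportional to nJ_n and −nJ_{−n}; in
the combination giving Y_n they cancel because J_{−n} = (−1)^n J_n. -/
theorem exists_isBesselSolution_besselY {ν ρ : ℝ} (hρ : |ν| < ρ) :
    ∃ y', IsBesselSolution ν ρ (fun _ => 0) (besselY ν) y' := by
  have h1 : -ρ < ν := by linarith [neg_abs_le ν]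
  have h2 : -ρ < -ν := by linarith [le_abs_self ν]
  by_cases hν : ∃ m : ℤ, ν = m
  · obtain ⟨n, rfl⟩ := hν
    refine ⟨_, (((isBesselSolution_besselJOrderDeriv rfl h1).add
      ((isBesselSolution_besselJOrderDeriv (by ring) h2).const_mul ((-1) ^ n))).const_mul
        (1 / Real.pi)).congr (fun x hx => ?_) fun x hx => besselY_intCast hx n⟩
    have hs2 : ((-1 : ℝ) ^ n) * (-1) ^ n = 1 := by rw [← mul_zpow]; simp
    rw [besselJ_neg_intCast hx]
    linear_combination (-(1 / Real.pi) * 2 * n * besselJ n x / x ^ 2) * hs2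
  · refine ⟨_, (((isBesselSolution_besselJ rfl h1).const_mul
      (Real.cos (ν * Real.pi) / Real.sin (ν * Real.pi))).add
      ((isBesselSolution_besselJ (by ring) h2).const_mul
        (-1 / Real.sin (ν * Real.pi)))).congr (fun x hx => by simp) fun x hx => ?_⟩
    rw [besselY, if_neg hν, besselYQuot]
    ring

theorem exists_hankelH1_solution {ν ρ : ℝ} (hρ : |ν| < ρ) :
    ∃ h' : ℝ → ℂ, (∀ x, 0 < x → HasDerivAt (hankelH1 ν) (h' x) x) ∧
      (∀ x, 0 < x →
        HasDerivAt h' (-(h' x) / x - (1 - ν ^ 2 / x ^ 2) * hankelH1 ν x) x) ∧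
      (hankelH1 ν =O[𝓝[>] 0] fun x => x ^ (-ρ)) ∧
      ((fun x => x * h' x) =O[𝓝[>] 0] fun x => x ^ (-ρ)) := by
  have hJ := isBesselSolution_besselJ (ν := ν) rfl (show -ρ < ν by linarith [neg_abs_le ν])
  obtain ⟨Y', hY⟩ := exists_isBesselSolution_besselY hρ
  have cast : ∀ {f g : ℝ → ℝ}, f =O[𝓝[>] 0] g → (fun x => (f x : ℂ)) =O[𝓝[>] 0] g :=
    fun h => Complex.isBigO_ofReal_left.2 h
  refine ⟨fun x => ((ν / x * besselJ ν x - besselJ (ν + 1) x : ℝ) : ℂ) + Complex.I * (Y' x : ℂ),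
    fun x hx => ?_, fun x hx => ?_, ?_, ?_⟩
  · exact (hJ.hasDerivAt x hx).ofReal_comp.add
      ((hY.hasDerivAt x hx).ofReal_comp.const_mul Complex.I)
  · convert! (hJ.hasDerivAt_deriv x hx).ofReal_comp.add
      ((hY.hasDerivAt_deriv x hx).ofReal_comp.const_mul Complex.I) using 1
    rw [hankelH1]
    push_cast
    ring
  · exact (cast hJ.isBigO).add ((cast hY.isBigO).const_mul_left Complex.I)
  · refine ((cast hJ.isBigO_deriv).add
      ((cast hY.isBigO_deriv).const_mul_left Complex.I)).congr_left fun x => ?_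
    push_cast
    ring

open MeasureTheory Set

/-! ### Differentiating integrals with respect to an exponent -/

/-- Lowering the exponent slightly pays for the logarithm: p^ε |log p| ≤ 1/ε on (0, 1]. The base p
is kept general so that it can be x or 1 − x, and F may already contain a logarithm. -/
theorem hasDerivAt_integral_rpow_mul {X : Type*} [MeasurableSpace X] {μ : Measure X} {p : X → ℝ}
    (hp : Measurable p) (hp01 : ∀ᵐ x ∂μ, 0 < p x ∧ p x ≤ 1) {F : X → ℂ} {A : ℝ}
    (hF : ∀ a, A < a → Integrable (fun x => ((p x ^ a : ℝ) : ℂ) * F x) μ) {a : ℝ} (ha : A < a) :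
    Integrable (fun x => (Real.log (p x) : ℂ) * (((p x ^ a : ℝ) : ℂ) * F x)) μ ∧
      HasDerivAt (fun a => ∫ x, ((p x ^ a : ℝ) : ℂ) * F x ∂μ)
        (∫ x, (Real.log (p x) : ℂ) * (((p x ^ a : ℝ) : ℂ) * F x) ∂μ) a := by
  -- One ε is for the neighbourhood of a and one for the logarithm; the majorant has exponent a −
  -- 2ε, still above A.
  set ε := (a - A) / 3 with hε
  have hε0 : 0 < ε := by rw [hε]; linarith
  have hlog : Measurable fun x => (Real.log (p x) : ℂ) :=
    Complex.measurable_ofReal.comp (Real.measurable_log.comp hp)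
  refine hasDerivAt_integral_of_dominated_loc_of_deriv_le (s := Ioi (a - ε))
    (F := fun a x => ((p x ^ a : ℝ) : ℂ) * F x)
    (F' := fun a x => (Real.log (p x) : ℂ) * (((p x ^ a : ℝ) : ℂ) * F x))
    (bound := fun x => 1 / ε * ‖((p x ^ (a - 2 * ε) : ℝ) : ℂ) * F x‖)
    (Ioi_mem_nhds (by linarith)) ?_ (hF a ha)
    (hlog.aestronglyMeasurable.mul (hF a ha).aestronglyMeasurable) ?_
    ((hF _ (by rw [hε]; linarith)).norm.const_mul _) ?_
  · filter_upwards [lt_mem_nhds ha] with b hb using (hF b hb).aestronglyMeasurable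
  · filter_upwards [hp01] with x hx b hb
    have hb' : a - ε < b := hb
    rw [norm_mul, norm_mul, norm_mul, ← mul_assoc, ← mul_assoc]
    refine mul_le_mul_of_nonneg_right ?_ (norm_nonneg _)
    rw [Complex.norm_real, Complex.norm_real, Complex.norm_real, ← norm_mul, Real.norm_eq_abs,
      Real.norm_eq_abs, abs_of_pos (Real.rpow_pos_of_pos hx.1 (a - 2 * ε)),
      show b = ε + (b - ε) by ring, Real.rpow_add hx.1, ← mul_assoc, abs_mul,
      abs_of_pos (Real.rpow_pos_of_pos hx.1 (b - ε))]
    refine mul_le_mul ?_ ?_ (Real.rpow_pos_of_pos hx.1 _).le (by positivity)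
    · exact (Real.abs_log_mul_self_rpow_lt _ _ hx.1 hx.2 hε0).le
    · exact Real.rpow_le_rpow_of_exponent_ge hx.1 hx.2 (by linarith)
  · filter_upwards [hp01] with x hx b _
    have h := ((Real.hasStrictDerivAt_const_rpow hx.1 b).hasDerivAt.ofReal_comp).mul_const (F x)
    convert! h using 1
    push_cast
    ring

/-! ### Integrability of the moments -/

theorem exists_norm_le_rpow {f : ℝ → ℂ} {ρ : ℝ} (hf : ContinuousOn f (Ioc 0 1))
    (hO : f =O[𝓝[>] 0] fun x => x ^ (-ρ)) : ∃ C, ∀ x ∈ Ioo (0 : ℝ) 1, ‖f x‖ ≤ C * x ^ (-ρ) := by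
  obtain ⟨C, hC⟩ := hO.bound
  obtain ⟨δ, hδ, hδC⟩ := (mem_nhdsGT_iff_exists_Ioo_subset (a := (0 : ℝ))).1 hC
  have hδ0 : 0 < δ := hδ
  have hcont : ContinuousOn (fun x => f x * ((x ^ ρ : ℝ) : ℂ)) (Icc (min δ 1) 1) := by
    refine (hf.mono fun x hx => ⟨?_, hx.2⟩).mul (Complex.continuous_ofReal.comp_continuousOn
      (continuousOn_id.rpow_const fun x hx => Or.inl ?_))
    · exact (lt_min hδ0 one_pos).trans_le hx.1
    · exact ((lt_min hδ0 one_pos).trans_le hx.1).ne'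
  obtain ⟨C', hC'⟩ := isCompact_Icc.exists_bound_of_continuousOn hcont
  refine ⟨max C C', fun x hx => ?_⟩
  have hpos : 0 < x ^ (-ρ) := Real.rpow_pos_of_pos hx.1 _
  by_cases hxδ : x < δ
  · have := hδC ⟨hx.1, hxδ⟩
    rw [mem_ofPred_eq, Real.norm_eq_abs, abs_of_pos hpos] at this
    exact this.trans (by gcongr; exact le_max_left _ _)
  · have := hC' x ⟨(min_le_left _ _).trans (not_lt.1 hxδ), hx.2.le⟩
    rw [norm_mul, Complex.norm_real, Real.norm_eq_abs, abs_of_pos (Real.rpow_pos_of_pos hx.1 _)]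
      at this
    rw [Real.rpow_neg hx.1.le, ← div_eq_mul_inv, le_div_iff₀ (Real.rpow_pos_of_pos hx.1 _)]
    exact this.trans (le_max_right _ _)

theorem integrableOn_rpow_mul_one_sub_rpow {a b : ℝ} (ha : -1 < a) (hb : -1 < b) :
    IntegrableOn (fun x : ℝ => x ^ a * (1 - x) ^ b) (Ioo 0 1) := by
  have h := Complex.betaIntegral_convergent (u := ((a + 1 : ℝ) : ℂ)) (v := ((b + 1 : ℝ) : ℂ))
    (by rw [Complex.ofReal_re]; linarith) (by rw [Complex.ofReal_re]; linarith)
  rw [intervalIntegrable_iff_integrableOn_Ioo_of_le zero_le_one] at h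
  refine IntegrableOn.congr_fun h.norm (fun x hx => ?_) measurableSet_Ioo
  have hx' : 0 < 1 - x := by linarith [hx.2]
  rw [norm_mul, Complex.norm_cpow_eq_rpow_re_of_pos hx.1,
    show (1 : ℂ) - x = ((1 - x : ℝ) : ℂ) by push_cast; rfl,
    Complex.norm_cpow_eq_rpow_re_of_pos hx']
  simp

/-- Comparison with the Beta integrand of exponents a − ρ and b. -/
theorem integrableOn_weight_mul {φ : ℝ → ℂ} {ρ a b : ℝ} (hφ : ContinuousOn φ (Ioc 0 1))
    (hO : φ =O[𝓝[>] 0] fun x => x ^ (-ρ)) (ha : ρ - 1 < a) (hb : -1 < b) :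
    IntegrableOn (fun x => ((x ^ a : ℝ) : ℂ) * ((((1 - x) ^ b : ℝ) : ℂ) * φ x)) (Ioo 0 1) := by
  obtain ⟨C, hC⟩ := exists_norm_le_rpow hφ hO
  refine Integrable.mono' ((integrableOn_rpow_mul_one_sub_rpow (a := a - ρ) (b := b)
    (by linarith) hb).const_mul C) ?_ ?_
  · refine ContinuousOn.aestronglyMeasurable ?_ measurableSet_Ioo
    refine ContinuousOn.mul ?_ (ContinuousOn.mul ?_ (hφ.mono Ioo_subset_Ioc_self))
    · exact Complex.continuous_ofReal.comp_continuousOn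
        (continuousOn_id.rpow_const fun x hx => Or.inl hx.1.ne')
    · refine Complex.continuous_ofReal.comp_continuousOn
        ((continuousOn_const.sub continuousOn_id).rpow_const fun x hx => Or.inl ?_)
      exact (sub_pos.2 hx.2).ne'
  · filter_upwards [ae_restrict_mem measurableSet_Ioo] with x hx
    have hx' : 0 < 1 - x := by linarith [hx.2]
    rw [norm_mul, norm_mul, Complex.norm_real, Complex.norm_real, Real.norm_eq_abs,
      Real.norm_eq_abs, abs_of_pos (Real.rpow_pos_of_pos hx.1 _),
      abs_of_pos (Real.rpow_pos_of_pos hx' _), Real.rpow_sub hx.1]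
    have h := hC x hx
    rw [Real.rpow_neg hx.1.le] at h
    calc x ^ a * ((1 - x) ^ b * ‖φ x‖) ≤ x ^ a * ((1 - x) ^ b * (C * (x ^ ρ)⁻¹)) := by
          have := Real.rpow_pos_of_pos hx.1 a
          have := Real.rpow_pos_of_pos hx' b
          gcongr
      _ = _ := by ring

/-- The factor of the moment integrand that does not depend on the exponents. -/
def momentFactor (ν k ω : ℝ) (n : ℤ) (x : ℝ) : ℂ :=
  (shiftedChebyshevT n x : ℂ) * Complex.exp (Complex.I * (2 * k * x)) * hankelH1 ν (ω * x)

theorem momentIntegrand_eq (ν k ω α β : ℝ) (n : ℤ) (x : ℝ) :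
    momentIntegrand ν k ω α β n x
      = ((x ^ α : ℝ) : ℂ) * ((((1 - x) ^ β : ℝ) : ℂ) * momentFactor ν k ω n x) := by
  rw [momentIntegrand, momentFactor]
  push_cast
  ring

theorem tendsto_mul_nhdsGT_zero {ω : ℝ} (hω : 0 < ω) :
    Tendsto (fun x : ℝ => ω * x) (𝓝[>] 0) (𝓝[>] 0) := by
  refine tendsto_nhdsWithin_of_tendsto_nhds_of_eventually_within _ ?_ ?_
  · have : Tendsto (fun x : ℝ => ω * x) (𝓝 0) (𝓝 (ω * 0)) := tendsto_id.const_mul ω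
    rw [mul_zero] at this
    exact this.mono_left nhdsWithin_le_nhds
  · filter_upwards [self_mem_nhdsWithin] with x hx using mul_pos hω hx

theorem isBigO_comp_mul_left {f : ℝ → ℂ} {ω ρ : ℝ} (hω : 0 < ω)
    (hf : f =O[𝓝[>] 0] fun x => x ^ (-ρ)) :
    (fun x => f (ω * x)) =O[𝓝[>] 0] fun x => x ^ (-ρ) := by
  refine (hf.comp_tendsto (tendsto_mul_nhdsGT_zero hω)).trans ?_
  refine ((Asymptotics.isBigO_refl (fun x : ℝ => x ^ (-ρ)) _).const_mul_left (ω ^ (-ρ))).congr' ?_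
    EventuallyEq.rfl
  filter_upwards [self_mem_nhdsWithin] with x hx
  rw [Function.comp, Real.mul_rpow hω.le (le_of_lt hx)]

theorem continuous_shiftedChebyshevT (n : ℤ) : Continuous (shiftedChebyshevT n) := by
  unfold shiftedChebyshevT
  fun_prop

theorem continuousOn_hankelH1 (ν : ℝ) : ContinuousOn (hankelH1 ν) (Ioi 0) := by
  obtain ⟨h', hd, -⟩ := exists_hankelH1_solution (lt_add_one |ν|)
  exact fun x hx => (hd x hx).continuousAt.continuousWithinAt

theorem continuousOn_momentFactor (ν k : ℝ) {ω : ℝ} (hω : 0 < ω) (n : ℤ) :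
    ContinuousOn (momentFactor ν k ω n) (Ioc 0 1) := by
  refine ContinuousOn.mul (Continuous.continuousOn ?_) ?_
  · have := continuous_shiftedChebyshevT n
    fun_prop
  · exact (continuousOn_hankelH1 ν).comp (by fun_prop) fun x hx => mul_pos hω hx.1

theorem momentFactor_isBigO {ν ρ ω : ℝ} (k : ℝ) (hω : 0 < ω) (n : ℤ) (hρ : |ν| < ρ) :
    momentFactor ν k ω n =O[𝓝[>] 0] fun x => x ^ (-ρ) := by
  obtain ⟨h', -, -, hO, -⟩ := exists_hankelH1_solution hρ
  have hc : Continuous fun x : ℝ =>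
      (shiftedChebyshevT n x : ℂ) * Complex.exp (Complex.I * (2 * k * x)) := by
    have := continuous_shiftedChebyshevT n
    fun_prop
  have h1 := ((hc.tendsto 0).isBigO_one ℝ).mono (nhdsWithin_le_nhds (s := Ioi 0))
  have h2 := h1.mul (isBigO_comp_mul_left hω hO)
  simp only [one_mul] at h2
  exact h2

theorem integrableOn_momentIntegrand {ν ω α β : ℝ} (k : ℝ) (hα : |ν| - 1 < α) (hβ : -1 < β)
    (hω : 0 < ω) (n : ℤ) :
    IntegrableOn
      (fun x => ((x ^ α : ℝ) : ℂ) * ((((1 - x) ^ β : ℝ) : ℂ) * momentFactor ν k ω n x))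
      (Ioo 0 1) := by
  obtain ⟨ρ, h1, h2⟩ := exists_between (show |ν| < α + 1 by linarith)
  exact integrableOn_weight_mul (continuousOn_momentFactor ν k hω n)
    (momentFactor_isBigO k hω n h1) (by linarith) hβ

theorem integral_zero_one_eq {f g : ℝ → ℂ} (h : ∀ x, f x = g x) :
    ∫ x in (0 : ℝ)..1, f x = ∫ x in Ioo (0 : ℝ) 1, g x := by
  rw [intervalIntegral.integral_of_le zero_le_one, integral_Ioc_eq_integral_Ioo, funext h]

theorem intervalIntegrable_zero_one {f g : ℝ → ℂ} (hg : IntegrableOn g (Ioo 0 1))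
    (h : ∀ x, f x = g x) : IntervalIntegrable f volume 0 1 := by
  rwa [intervalIntegrable_iff_integrableOn_Ioo_of_le zero_le_one, funext h]

theorem ae_Ioo_zero_one :
    (∀ᵐ x ∂volume.restrict (Ioo (0 : ℝ) 1), 0 < x ∧ x ≤ 1) ∧
      ∀ᵐ x ∂volume.restrict (Ioo (0 : ℝ) 1), 0 < 1 - x ∧ 1 - x ≤ 1 := by
  constructor <;> filter_upwards [ae_restrict_mem measurableSet_Ioo] with x hx
  · exact ⟨hx.1, hx.2.le⟩
  · exact ⟨by linarith [hx.2], by linarith [hx.1]⟩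

theorem intervalIntegrable_momentIntegrand {ν ω α β : ℝ} (k : ℝ) (hα : |ν| - 1 < α) (hβ : -1 < β)
    (hω : 0 < ω) (n : ℤ) :
    IntervalIntegrable (fun x => momentIntegrand ν k ω α β n x) volume 0 1 :=
  intervalIntegrable_zero_one (integrableOn_momentIntegrand k hα hβ hω n) fun x =>
    momentIntegrand_eq ν k ω α β n x

/-! ### Logarithmic moments as derivatives in the exponents -/

theorem logMoment1_spec {ν ω α β : ℝ} (k : ℝ) (hα : |ν| - 1 < α) (hβ : -1 < β)
    (hω : 0 < ω) (n : ℤ) :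
    IntervalIntegrable (fun x : ℝ => (Real.log x : ℂ) * momentIntegrand ν k ω α β n x) volume 0 1 ∧
      HasDerivAt (fun a => moment ν k ω a β n) (logMoment1 ν k ω α β n) α := by
  have h := hasDerivAt_integral_rpow_mul (p := fun x => x) measurable_id ae_Ioo_zero_one.1
    (fun a ha => integrableOn_momentIntegrand k ha hβ hω n) hα
  refine ⟨intervalIntegrable_zero_one h.1 fun x => by rw [momentIntegrand_eq], ?_⟩
  convert! h.2 using 1
  · exact funext fun a => integral_zero_one_eq fun x => momentIntegrand_eq ν k ω a β n x
  · exact integral_zero_one_eq fun x => by rw [momentIntegrand_eq]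

theorem logMoment2_spec {ν ω α β : ℝ} (k : ℝ) (hα : |ν| - 1 < α) (hβ : -1 < β)
    (hω : 0 < ω) (n : ℤ) :
    IntervalIntegrable (fun x : ℝ => (Real.log (1 - x) : ℂ) * momentIntegrand ν k ω α β n x)
        volume 0 1 ∧
      HasDerivAt (fun b => moment ν k ω α b n) (logMoment2 ν k ω α β n) β := by
  have h := hasDerivAt_integral_rpow_mul (p := fun x : ℝ => 1 - x) (by fun_prop) ae_Ioo_zero_one.2
    (F := fun x => ((x ^ α : ℝ) : ℂ) * momentFactor ν k ω n x)
    (fun b hb => (integrableOn_momentIntegrand k hα hb hω n).congr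
      (ae_of_all _ fun x => by ring)) hβ
  have e : ∀ b x, momentIntegrand ν k ω α b n x
      = (((1 - x) ^ b : ℝ) : ℂ) * (((x ^ α : ℝ) : ℂ) * momentFactor ν k ω n x) := fun b x => by
    rw [momentIntegrand_eq]; ring
  refine ⟨intervalIntegrable_zero_one h.1 fun x => by rw [e], ?_⟩
  convert! h.2 using 1
  · exact funext fun a => integral_zero_one_eq fun x => e a x
  · exact integral_zero_one_eq fun x => by rw [e]

/-- The integrability obtained for the factor ln(1−x), for all admissible exponents of x, is the
hypothesis needed to differentiate once more. -/
theorem logMoment3_spec_left {ν ω α β : ℝ} (k : ℝ) (hα : |ν| - 1 < α) (hβ : -1 < β)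
    (hω : 0 < ω) (n : ℤ) :
    IntervalIntegrable (fun x : ℝ =>
        (Real.log x : ℂ) * (Real.log (1 - x) : ℂ) * momentIntegrand ν k ω α β n x) volume 0 1 ∧
      HasDerivAt (fun a => logMoment2 ν k ω a β n) (logMoment3 ν k ω α β n) α := by
  have e : ∀ a (x : ℝ), (Real.log (1 - x) : ℂ) * momentIntegrand ν k ω a β n x
      = ((x ^ a : ℝ) : ℂ) * ((Real.log (1 - x) : ℂ) *
        ((((1 - x) ^ β : ℝ) : ℂ) * momentFactor ν k ω n x)) := fun a x => by
    rw [momentIntegrand_eq]; ring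
  have h := hasDerivAt_integral_rpow_mul (p := fun x => x) measurable_id ae_Ioo_zero_one.1
    (F := fun x => (Real.log (1 - x) : ℂ) *
        ((((1 - x) ^ β : ℝ) : ℂ) * momentFactor ν k ω n x))
    (fun a ha => ((intervalIntegrable_iff_integrableOn_Ioo_of_le zero_le_one).1
      (logMoment2_spec k ha hβ hω n).1).congr (ae_of_all _ fun x => e a x)) hα
  refine ⟨intervalIntegrable_zero_one h.1 fun x => by rw [mul_assoc, e], ?_⟩
  convert! h.2 using 1
  · exact funext fun a => integral_zero_one_eq fun x => e a x
  · exact integral_zero_one_eq fun x => by rw [mul_assoc, e]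

theorem logMoment3_spec_right {ν ω α β : ℝ} (k : ℝ) (hα : |ν| - 1 < α) (hβ : -1 < β)
    (hω : 0 < ω) (n : ℤ) :
    HasDerivAt (fun b => logMoment1 ν k ω α b n) (logMoment3 ν k ω α β n) β := by
  have e : ∀ b (x : ℝ), (Real.log x : ℂ) * momentIntegrand ν k ω α b n x
      = (((1 - x) ^ b : ℝ) : ℂ) * ((Real.log x : ℂ) *
        (((x ^ α : ℝ) : ℂ) * momentFactor ν k ω n x)) := fun b x => by
    rw [momentIntegrand_eq]; ring
  have h := hasDerivAt_integral_rpow_mul (p := fun x : ℝ => 1 - x) (by fun_prop) ae_Ioo_zero_one.2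
    (F := fun x => (Real.log x : ℂ) * (((x ^ α : ℝ) : ℂ) * momentFactor ν k ω n x))
    (fun b hb => ((intervalIntegrable_iff_integrableOn_Ioo_of_le zero_le_one).1
      (logMoment1_spec k hα hb hω n).1).congr (ae_of_all _ fun x => e b x)) hβ
  convert! h.2 using 1
  · exact funext fun a => integral_zero_one_eq fun x => e a x
  · exact integral_zero_one_eq fun x => by
      rw [mul_comm (Real.log x : ℂ), mul_assoc, e]

/-! ### Shifted Chebyshev polynomials -/

/-- Shifted Chebyshev polynomial of the second kind. -/
def shiftedChebyshevU (n : ℤ) (x : ℝ) : ℝ := (Polynomial.Chebyshev.U ℝ n).eval (2 * x - 1)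

/-- With y = 2x − 1 one has 1 − y² = 4x(1−x). This and its mirror image at n − 1 start the reduction
of all nine polynomials to T_n and U_{n−1}. -/
theorem shiftedChebyshevT_add_one (n : ℤ) (x : ℝ) :
    shiftedChebyshevT (n + 1) x
      = (2 * x - 1) * shiftedChebyshevT n x - 4 * x * (1 - x) * shiftedChebyshevU (n - 1) x := by
  have h := congrArg (Polynomial.eval (2 * x - 1))
    (Polynomial.Chebyshev.T_eq_X_mul_T_sub_pol_U ℝ (n - 1))
  rw [show n - 1 + 2 = n + 1 by ring, sub_add_cancel] at h
  simp at h
  rw [shiftedChebyshevT, shiftedChebyshevT, shiftedChebyshevU, h]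
  ring

theorem shiftedChebyshevT_add_two (n : ℤ) (x : ℝ) :
    shiftedChebyshevT (n + 2) x
      = 2 * (2 * x - 1) * shiftedChebyshevT (n + 1) x - shiftedChebyshevT n x := by
  simp [shiftedChebyshevT, Polynomial.Chebyshev.T_add_two]

theorem shiftedChebyshevT_sub_two (n : ℤ) (x : ℝ) :
    shiftedChebyshevT (n - 2) x
      = 2 * (2 * x - 1) * shiftedChebyshevT (n - 1) x - shiftedChebyshevT n x := by
  have h := congrArg (Polynomial.eval (2 * x - 1)) (Polynomial.Chebyshev.T_sub_two ℝ n)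
  simpa [shiftedChebyshevT] using h

theorem shiftedChebyshevT_sub_one (n : ℤ) (x : ℝ) :
    shiftedChebyshevT (n - 1) x
      = (2 * x - 1) * shiftedChebyshevT n x + 4 * x * (1 - x) * shiftedChebyshevU (n - 1) x := by
  have h1 := shiftedChebyshevT_add_two (n - 1) x
  rw [show n - 1 + 2 = n + 1 by ring, sub_add_cancel] at h1
  linear_combination h1 - shiftedChebyshevT_add_one n x

theorem hasDerivAt_shiftedChebyshevT (n : ℤ) (x : ℝ) :
    HasDerivAt (shiftedChebyshevT n) (2 * n * shiftedChebyshevU (n - 1) x) x := by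
  have h := ((Polynomial.Chebyshev.T ℝ n).hasDerivAt (2 * x - 1)).comp x
    (((hasDerivAt_id x).const_mul 2).sub_const 1)
  rw [Polynomial.Chebyshev.T_derivative_eq_U] at h
  convert! h using 1
  simp [shiftedChebyshevU]
  ring

/-- Second derivative of the shifted Chebyshev polynomial, with the Chebyshev equation. -/
theorem exists_hasDerivAt_shiftedChebyshevU (n : ℤ) (x : ℝ) :
    ∃ t₂, HasDerivAt (fun x => 2 * n * shiftedChebyshevU (n - 1) x) t₂ x ∧
      x * (1 - x) * t₂
        = (2 * x - 1) * n * shiftedChebyshevU (n - 1) x - n ^ 2 * shiftedChebyshevT n x := by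
  have h := ((Polynomial.derivative (Polynomial.Chebyshev.T ℝ n)).hasDerivAt (2 * x - 1)).comp x
    (((hasDerivAt_id x).const_mul 2).sub_const 1)
  have e := congrArg (Polynomial.eval (2 * x - 1))
    (Polynomial.Chebyshev.one_sub_X_sq_mul_derivative_derivative_T_eq_poly_in_T (R := ℝ) n)
  refine ⟨_, (h.const_mul 2).congr_of_eventuallyEq (Eventually.of_forall fun y => ?_), ?_⟩
  · simp [Polynomial.Chebyshev.T_derivative_eq_U, shiftedChebyshevU]
    ring
  · rw [Function.iterate_succ, Function.iterate_one, Function.comp_apply] at e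
    simp only [Polynomial.eval_mul, Polynomial.eval_sub, Polynomial.eval_one, Polynomial.eval_pow,
      Polynomial.eval_X, Polynomial.eval_intCast] at e
    rw [show Polynomial.eval (2 * x - 1) (Polynomial.derivative (Polynomial.Chebyshev.T ℝ n))
      = n * shiftedChebyshevU (n - 1) x by
        simp [Polynomial.Chebyshev.T_derivative_eq_U, shiftedChebyshevU]] at e
    rw [shiftedChebyshevT]
    linear_combination e

/-! ### The recurrence for the moments -/

/-- Expansion of the Chebyshev side of the recurrence in terms of `T_n` and `U_{n-1}`. -/
theorem nineTerm_shiftedChebyshevT (ν k ω α β : ℝ) (n : ℤ) (x : ℝ) {t₂ : ℂ} {h g h₂ : ℂ}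
    (ht₂ : (x * (1 - x) * t₂ : ℂ)
      = (2 * x - 1) * n * shiftedChebyshevU (n - 1) x - n ^ 2 * shiftedChebyshevT n x)
    (hh₂ : x ^ 2 * h₂ = -x * g - (ω ^ 2 * x ^ 2 - ν ^ 2) * h) {t t₁ q₁ p : ℂ}
    (ht : t = shiftedChebyshevT n x) (ht₁ : t₁ = 2 * n * shiftedChebyshevU (n - 1) x)
    (hq₁ : q₁ = t₁ + 2 * Complex.I * k * t) (hp : p = (α + 2) * (1 - x) - (β + 2) * x) :
    h * nineTerm ν k ω α β (fun m => (shiftedChebyshevT m x : ℂ)) n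
      = 16 * (((α + 1) * (1 - x) - (β + 1) * x + 2 * Complex.I * k * x * (1 - x))
          * (h * (p * t + x * (1 - x) * q₁) - x * g * (1 - x) * t - h * (1 - x) * t)
        + x * (1 - x) * (g * (p * t + x * (1 - x) * q₁)
          + h * (-(α + β + 4) * t + p * t₁ + (1 - 2 * x) * q₁
            + x * (1 - x) * (t₂ + 2 * Complex.I * k * t₁))
          - (g + x * h₂) * (1 - x) * t + x * g * t - x * g * (1 - x) * t₁
          - g * (1 - x) * t + h * t - h * (1 - x) * t₁)) := by
  have e1 := shiftedChebyshevT_add_one n x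
  have e2 := shiftedChebyshevT_add_two n x
  have e3 := shiftedChebyshevT_add_two (n + 1) x
  have e4 := shiftedChebyshevT_add_two (n + 2) x
  have d1 := shiftedChebyshevT_sub_one n x
  have d2 := shiftedChebyshevT_sub_two n x
  have d3 := shiftedChebyshevT_sub_two (n - 1) x
  have d4 := shiftedChebyshevT_sub_two (n - 2) x
  rw [show n + 1 + 2 = n + 3 by ring, show n + 1 + 1 = n + 2 by ring] at e3
  rw [show n + 2 + 2 = n + 4 by ring, show n + 2 + 1 = n + 3 by ring] at e4
  rw [show n - 1 - 2 = n - 3 by ring, show n - 1 - 1 = n - 2 by ring] at d3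
  rw [show n - 2 - 2 = n - 4 by ring, show n - 2 - 1 = n - 3 by ring] at d4
  simp only [nineTerm, recCoeff1, recCoeff2, recCoeff3, recCoeff4]
  rw [e4, e3, e2, e1, d4, d3, d2, d1]
  push_cast
  subst ht₁ hq₁ hp
  rw [← ht] at ht₂ ⊢
  generalize (shiftedChebyshevU (n - 1) x : ℂ) = u at *
  have hI : Complex.I ^ 2 = -1 := Complex.I_sq
  -- Only polynomial algebra remains, modulo the Chebyshev equation, the Bessel equation and i² =
  -- −1. The multiplier 16(1−x)²t of the Bessel equation is 16φ without its weight.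
  linear_combination (-16 * x * (1 - x) * h) * ht₂
    + (16 * (1 - x) ^ 2 * t) * hh₂ + (-64 * k ^ 2 * h * t * x ^ 2 * (1 - x) ^ 2) * hI

/-- The bracket in the bilinear concomitant of the Bessel operator; `h` is the solution and `g` its
derivative. -/
def concomitantBracket (k α β : ℝ) (n : ℤ) (h g : ℝ → ℂ) (x : ℝ) : ℂ :=
  h x * (((α + 2) * (1 - x) - (β + 2) * x) * shiftedChebyshevT n x
      + x * (1 - x) * ((2 * n * shiftedChebyshevU (n - 1) x : ℝ)
        + 2 * Complex.I * k * shiftedChebyshevT n x))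
    - x * g x * ((1 - x) * shiftedChebyshevT n x) - h x * ((1 - x) * shiftedChebyshevT n x)

/-- The bilinear concomitant, whose derivative is the integrand of the nine-term recurrence. -/
def concomitant (k α β : ℝ) (n : ℤ) (h g : ℝ → ℂ) (x : ℝ) : ℂ :=
  ((x ^ (α + 1) : ℝ) : ℂ) * ((((1 - x) ^ (β + 1) : ℝ) : ℂ) *
    (Complex.exp (Complex.I * (2 * k * x)) * concomitantBracket k α β n h g x))

/-- Lagrange's identity for the Bessel operator, with the term φ Lh dropped because h is a solution.
-/
theorem hasDerivAt_concomitant {ν k ω α β : ℝ} (n : ℤ) {h g : ℝ → ℂ} {x : ℝ}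
    (hx : x ∈ Ioo (0 : ℝ) 1) (hh : HasDerivAt h (g x) x)
    (hg : HasDerivAt g (-(g x) / x - (ω ^ 2 - ν ^ 2 / x ^ 2) * h x) x) :
    HasDerivAt (fun x => 16 * concomitant k α β n h g x)
      (((x ^ α : ℝ) : ℂ) * (((1 - x) ^ β : ℝ) : ℂ) * Complex.exp (Complex.I * (2 * k * x)) *
        (h x * nineTerm ν k ω α β (fun m => (shiftedChebyshevT m x : ℂ)) n)) x := by
  have hx0 : x ≠ 0 := hx.1.ne'
  have hx1 : 1 - x ≠ 0 := (sub_pos.2 hx.2).ne'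
  obtain ⟨t₂, ht₂, ht₂'⟩ := exists_hasDerivAt_shiftedChebyshevU n x
  have hid : HasDerivAt (fun x : ℝ => (x : ℂ)) 1 x := by
    simpa using (hasDerivAt_id x).ofReal_comp
  have hsub : HasDerivAt (fun x : ℝ => (1 - x : ℂ)) (-1) x := by simpa using hid.const_sub 1
  have hpa : HasDerivAt (fun x : ℝ => ((x ^ (α + 1) : ℝ) : ℂ))
      ((α + 1) * ((x ^ α : ℝ) : ℂ)) x := by
    have := ((hasDerivAt_id x).rpow_const (p := α + 1) (Or.inl hx0)).ofReal_comp
    convert! this using 1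
    simp
  have hpb : HasDerivAt (fun x : ℝ => (((1 - x) ^ (β + 1) : ℝ) : ℂ))
      (-((β + 1) * (((1 - x) ^ β : ℝ) : ℂ))) x := by
    have := (((hasDerivAt_id x).const_sub 1).rpow_const (p := β + 1) (Or.inl hx1)).ofReal_comp
    convert! this using 1
    simp
    ring
  have hE : HasDerivAt (fun x : ℝ => Complex.exp (Complex.I * (2 * k * x)))
      (Complex.exp (Complex.I * (2 * k * x)) * (Complex.I * (2 * k))) x := by
    simpa using ((hid.const_mul (2 * k : ℂ)).const_mul Complex.I).cexp
  have hT := (hasDerivAt_shiftedChebyshevT n x).ofReal_comp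
  have hU := ht₂.ofReal_comp
  have hP : HasDerivAt (fun x : ℝ => ((α + 2) * (1 - x) - (β + 2) * x : ℂ))
      ((α + 2) * (-1) - (β + 2) * 1) x := (hsub.const_mul _).sub (hid.const_mul _)
  have hB := ((hh.mul ((hP.mul hT).add ((hid.mul hsub).mul
    (hU.add (hT.const_mul (2 * Complex.I * k)))))).sub ((hid.mul hg).mul (hsub.mul hT))).sub
    (hh.mul (hsub.mul hT))
  have hW := (hpa.mul (hpb.mul (hE.mul hB))).const_mul 16
  convert! hW using 1
  have key := nineTerm_shiftedChebyshevT ν k ω α β n x (t₂ := t₂) (h := h x) (g := g x)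
    (h₂ := -(g x) / x - (ω ^ 2 - ν ^ 2 / x ^ 2) * h x) (by exact_mod_cast ht₂')
    (by
      have : (x : ℂ) ≠ 0 := by exact_mod_cast hx0
      field_simp) rfl rfl rfl rfl
  have ea : x ^ (α + 1) = x ^ α * x := Real.rpow_add_one hx0 α
  have eb : (1 - x) ^ (β + 1) = (1 - x) ^ β * (1 - x) := Real.rpow_add_one hx1 β
  rw [key]
  simp only [Pi.mul_apply, Pi.add_apply, Pi.sub_apply]
  rw [ea, eb]
  push_cast
  ring

theorem continuous_shiftedChebyshevU (n : ℤ) : Continuous (shiftedChebyshevU n) := by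
  unfold shiftedChebyshevU
  fun_prop

/-- The bracket involves only h and xg, never g alone, so it is O(x^(−ρ)) and is beaten by x^(α+1).
-/
theorem tendsto_concomitant_zero {k α β ρ : ℝ} (n : ℤ) {h g : ℝ → ℂ} (hρ : ρ < α + 1)
    (hβ : -1 < β) (hh : h =O[𝓝[>] 0] fun x => x ^ (-ρ))
    (hg : (fun x => x * g x) =O[𝓝[>] 0] fun x => x ^ (-ρ)) :
    Tendsto (concomitant k α β n h g) (𝓝[>] 0) (𝓝 0) := by
  have cO : ∀ {f : ℝ → ℂ}, Continuous f → f =O[𝓝[>] 0] fun _ => (1 : ℝ) := fun hf =>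
    ((hf.tendsto 0).isBigO_one ℝ).mono nhdsWithin_le_nhds
  have cT := continuous_shiftedChebyshevT n
  have cU := continuous_shiftedChebyshevU (n - 1)
  have c1 : Continuous fun x : ℝ => ((((α + 2) * (1 - x) - (β + 2) * x) * shiftedChebyshevT n x
      + x * (1 - x) * ((2 * n * shiftedChebyshevU (n - 1) x : ℝ)
        + 2 * Complex.I * k * shiftedChebyshevT n x)) : ℂ) := by fun_prop
  have c2 : Continuous fun x : ℝ => ((1 - x) * shiftedChebyshevT n x : ℂ) := by fun_prop
  have c3 : Continuous fun x : ℝ => Complex.exp (Complex.I * (2 * k * x)) := by fun_prop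
  have c4 : Continuous fun x : ℝ => (((1 - x) ^ (β + 1) : ℝ) : ℂ) :=
    Complex.continuous_ofReal.comp
      ((continuous_const.sub continuous_id).rpow_const fun x => Or.inr (by linarith))
  have hB := (((hh.mul (cO c1)).sub (hg.mul (cO c2))).sub (hh.mul (cO c2)))
  simp only [mul_one] at hB
  have hB2 := (cO c4).mul ((cO c3).mul hB)
  simp only [one_mul] at hB2
  have hpow : (fun x : ℝ => ((x ^ (α + 1) : ℝ) : ℂ)) =O[𝓝[>] 0] fun x : ℝ => x ^ (α + 1) :=
    Complex.isBigO_ofReal_left.2 (Asymptotics.isBigO_refl _ _)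
  refine (hpow.mul hB2).trans_tendsto ?_
  have h0 : Tendsto (fun x : ℝ => x ^ (α + 1 - ρ)) (𝓝[>] 0) (𝓝 0) := by
    have := (Real.continuousAt_rpow_const 0 (α + 1 - ρ) (Or.inr (by linarith))).tendsto
    rw [Real.zero_rpow (by linarith)] at this
    exact this.mono_left nhdsWithin_le_nhds
  refine h0.congr' ?_
  filter_upwards [self_mem_nhdsWithin] with x hx
  rw [← Real.rpow_add hx, sub_eq_add_neg]

theorem tendsto_concomitant_one {k α β : ℝ} (n : ℤ) {h g : ℝ → ℂ} (hβ : -1 < β)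
    (hh : ContinuousAt h 1) (hg : ContinuousAt g 1) :
    Tendsto (concomitant k α β n h g) (𝓝[<] 1) (𝓝 0) := by
  have cT := (continuous_shiftedChebyshevT n).continuousAt (x := 1)
  have cU := (continuous_shiftedChebyshevU (n - 1)).continuousAt (x := 1)
  have c1 : ContinuousAt (fun x : ℝ => ((x ^ (α + 1) : ℝ) : ℂ)) 1 :=
    Complex.continuous_ofReal.continuousAt.comp
      (Real.continuousAt_rpow_const 1 (α + 1) (Or.inl one_ne_zero))
  have c2 : ContinuousAt (fun x : ℝ => (((1 - x) ^ (β + 1) : ℝ) : ℂ)) 1 :=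
    (Complex.continuous_ofReal.comp
      ((continuous_const.sub continuous_id).rpow_const fun x => Or.inr (by linarith))).continuousAt
  have hc : ContinuousAt (concomitant k α β n h g) 1 := by
    unfold concomitant concomitantBracket
    fun_prop
  have h0 : concomitant k α β n h g 1 = 0 := by
    rw [concomitant, sub_self, Real.zero_rpow (by linarith)]
    simp
  have := hc.tendsto
  rw [h0] at this
  exact this.mono_left nhdsWithin_le_nhds

theorem nineTerm_integral (ν k ω α β : ℝ) {F : ℤ → ℝ → ℂ}
    (hF : ∀ m, IntervalIntegrable (F m) volume 0 1) (n : ℤ) :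
    IntervalIntegrable (fun x => nineTerm ν k ω α β (fun m => F m x) n) volume 0 1 ∧
    nineTerm ν k ω α β (fun m => ∫ x in (0 : ℝ)..1, F m x) n
      = ∫ x in (0 : ℝ)..1, nineTerm ν k ω α β (fun m => F m x) n := by
  have hi : ∀ (c : ℂ) m, IntervalIntegrable (fun x => c * F m x) volume 0 1 :=
    fun c m => (hF m).const_mul c
  simp only [nineTerm]
  constructor
  · repeat' first | exact hi _ _ | refine IntervalIntegrable.add ?_ ?_
  · rw [intervalIntegral.integral_add, intervalIntegral.integral_add, intervalIntegral.integral_add,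
      intervalIntegral.integral_add, intervalIntegral.integral_add, intervalIntegral.integral_add,
      intervalIntegral.integral_add, intervalIntegral.integral_add]
    · simp only [intervalIntegral.integral_const_mul]
    all_goals repeat' first | exact hi _ _ | refine IntervalIntegrable.add ?_ ?_

theorem nineTerm_const_mul (ν k ω α β : ℝ) (c : ℂ) (S : ℤ → ℂ) (n : ℤ) :
    nineTerm ν k ω α β (fun m => c * S m) n = c * nineTerm ν k ω α β S n := by
  simp only [nineTerm]
  ring

/-- The integrand is an exact derivative whose primitive tends to 0 at both ends. -/
theorem nineTerm_moment {ν ω α β : ℝ} (k : ℝ) (hα : |ν| - 1 < α) (hβ : -1 < β) (hω : 0 < ω)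
    (n : ℤ) : nineTerm ν k ω α β (moment ν k ω α β) n = 0 := by
  -- Any ρ strictly in between works: above |ν| for the growth of the Hankel function, below α + 1
  -- for the boundary term.
  obtain ⟨ρ, h1, h2⟩ := exists_between (show |ν| < α + 1 by linarith)
  obtain ⟨H', hd, hd', hO, hO'⟩ := exists_hankelH1_solution h1
  set h : ℝ → ℂ := fun x => hankelH1 ν (ω * x) with hh
  set g : ℝ → ℂ := fun x => ω * H' (ω * x) with hg
  have hmul : ∀ x : ℝ, HasDerivAt (fun x : ℝ => ω * x) ω x := fun x => by
    simpa using (hasDerivAt_id x).const_mul ω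
  have dh : ∀ x, 0 < x → HasDerivAt h (g x) x := fun x hx => by
    have := (hd (ω * x) (mul_pos hω hx)).scomp x (hmul x)
    simpa [Function.comp_def] using this
  have dg : ∀ x, 0 < x →
      HasDerivAt g (-(g x) / x - (ω ^ 2 - ν ^ 2 / x ^ 2) * h x) x := fun x hx => by
    have := ((hd' (ω * x) (mul_pos hω hx)).scomp x (hmul x)).const_mul (ω : ℂ)
    convert! this using 1
    have hx' : (x : ℂ) ≠ 0 := by exact_mod_cast hx.ne'
    have hω' : (ω : ℂ) ≠ 0 := by exact_mod_cast hω.ne'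
    rw [hg, hh, Complex.real_smul]
    push_cast
    field_simp
  have Oh : h =O[𝓝[>] 0] fun x => x ^ (-ρ) := isBigO_comp_mul_left hω hO
  have Og : (fun x => x * g x) =O[𝓝[>] 0] fun x => x ^ (-ρ) := by
    refine (isBigO_comp_mul_left hω hO').congr_left fun x => ?_
    rw [hg]
    push_cast
    ring
  obtain ⟨hint, heq⟩ := nineTerm_integral ν k ω α β
    (fun m => intervalIntegrable_momentIntegrand k hα hβ hω m) n
  have e : ∀ x : ℝ, nineTerm ν k ω α β (fun m => momentIntegrand ν k ω α β m x) n
      = ((x ^ α : ℝ) : ℂ) * (((1 - x) ^ β : ℝ) : ℂ) * Complex.exp (Complex.I * (2 * k * x)) *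
        (h x * nineTerm ν k ω α β (fun m => (shiftedChebyshevT m x : ℂ)) n) := fun x => by
    rw [← mul_assoc, ← nineTerm_const_mul]
    congr 1
    ext m
    rw [momentIntegrand_eq, momentFactor]
    ring
  refine heq.trans ?_
  have ftc := intervalIntegral.integral_eq_sub_of_hasDerivAt_of_tendsto (zero_lt_one' ℝ)
    (f := fun x => 16 * concomitant k α β n h g x) (fa := 16 * 0) (fb := 16 * 0)
    (fun x hx => by
      rw [e x]
      exact hasDerivAt_concomitant n hx (dh x hx.1) (dg x hx.1)) hint
    ((tendsto_concomitant_zero n h2 hβ Oh Og).const_mul 16)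
    ((tendsto_concomitant_one n hβ (dh 1 one_pos).continuousAt
      (dg 1 one_pos).continuousAt).const_mul 16)
  rw [ftc, sub_self]

/-! ### Differentiating the recurrence -/

theorem hasDerivAt_of_eq_quadratic {f : ℝ → ℂ} {c₀ c₁ c₂ : ℂ}
    (hf : ∀ a : ℝ, f a = c₀ + c₁ * a + c₂ * a ^ 2) (a : ℝ) :
    HasDerivAt f (c₁ + 2 * c₂ * a) a := by
  have hid : HasDerivAt (fun x : ℝ => (x : ℂ)) 1 a := by
    simpa using (hasDerivAt_id a).ofReal_comp
  rw [funext hf]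
  convert! ((hid.const_mul c₁).const_add c₀).add ((hid.pow 2).const_mul c₂) using 1
  push_cast
  ring

/-- Product rule: −`logRhs1` collects the terms in which a coefficient is differentiated. -/
theorem hasDerivAt_nineTerm_left (ν k ω : ℝ) {α β : ℝ} {S : ℝ → ℤ → ℂ} {S' : ℤ → ℂ}
    (hS : ∀ m, HasDerivAt (fun a => S a m) (S' m) α) (n : ℤ) :
    HasDerivAt (fun a => nineTerm ν k ω a β (S a) n)
      (nineTerm ν k ω α β S' n - logRhs1 k α β (S α) n) α := by
  have h1 : ∀ n, HasDerivAt (fun a => recCoeff1 k a β n) (Complex.I * k + 2 * 0 * α) α := fun n =>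
    hasDerivAt_of_eq_quadratic (c₀ := recCoeff1 k 0 β n)
      (fun a => by simp only [recCoeff1]; push_cast; ring) α
  have h2 : ∀ n, HasDerivAt (fun a => recCoeff2 ν k ω a β n)
      (6 + 2 * β + 2 * n - 2 * Complex.I * k + 2 * 1 * α) α := fun n =>
    hasDerivAt_of_eq_quadratic (c₀ := recCoeff2 ν k ω 0 β n)
      (fun a => by simp only [recCoeff2]; push_cast; ring) α
  have h3 : ∀ n, HasDerivAt (fun a => recCoeff3 ν k a β n)
      (-8 - Complex.I * k - 4 * n + 2 * (-4) * α) α := fun n =>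
    hasDerivAt_of_eq_quadratic (c₀ := recCoeff3 ν k 0 β n)
      (fun a => by simp only [recCoeff3]; push_cast; ring) α
  have h4 : HasDerivAt (fun a => recCoeff4 ν k ω a β n)
      (4 - 4 * β + 4 * Complex.I * k + 2 * 6 * α) α :=
    hasDerivAt_of_eq_quadratic (c₀ := recCoeff4 ν k ω 0 β n)
      (fun a => by simp only [recCoeff4]; push_cast; ring) α
  have hc := fun m => (hS m).const_mul (1 / 16 * ω ^ 2 - 1 / 4 * k ^ 2 : ℂ)
  have := (((((((((hc (n + 4)).add ((h1 n).mul (hS (n + 3)))).add ((h2 n).mul (hS (n + 2)))).add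
    ((h3 n).mul (hS (n + 1)))).add (h4.mul (hS n))).add ((h3 (-n)).mul (hS (n - 1)))).add
    ((h2 (-n)).mul (hS (n - 2)))).add ((h1 (-n)).mul (hS (n - 3)))).add (hc (n - 4)))
  convert! this using 1
  simp only [nineTerm, logRhs1]
  push_cast
  ring

theorem hasDerivAt_nineTerm_right (ν k ω : ℝ) {α β : ℝ} {S : ℝ → ℤ → ℂ} {S' : ℤ → ℂ}
    (hS : ∀ m, HasDerivAt (fun b => S b m) (S' m) β) (n : ℤ) :
    HasDerivAt (fun b => nineTerm ν k ω α b (S b) n)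
      (nineTerm ν k ω α β S' n - logRhs2 k α β (S β) n) β := by
  have h1 : ∀ n, HasDerivAt (fun b => recCoeff1 k α b n) (Complex.I * k + 2 * 0 * β) β := fun n =>
    hasDerivAt_of_eq_quadratic (c₀ := recCoeff1 k α 0 n)
      (fun a => by simp only [recCoeff1]; push_cast; ring) β
  have h2 : ∀ n, HasDerivAt (fun b => recCoeff2 ν k ω α b n)
      (6 + 2 * α + 2 * n + 2 * Complex.I * k + 2 * 1 * β) β := fun n =>
    hasDerivAt_of_eq_quadratic (c₀ := recCoeff2 ν k ω α 0 n)
      (fun a => by simp only [recCoeff2]; push_cast; ring) β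
  have h3 : ∀ n, HasDerivAt (fun b => recCoeff3 ν k α b n)
      (12 - Complex.I * k + 4 * n + 2 * 4 * β) β := fun n =>
    hasDerivAt_of_eq_quadratic (c₀ := recCoeff3 ν k α 0 n)
      (fun a => by simp only [recCoeff3]; push_cast; ring) β
  have h4 : HasDerivAt (fun b => recCoeff4 ν k ω α b n)
      (12 - 4 * α - 4 * Complex.I * k + 2 * 6 * β) β :=
    hasDerivAt_of_eq_quadratic (c₀ := recCoeff4 ν k ω α 0 n)
      (fun a => by simp only [recCoeff4]; push_cast; ring) β
  have hc := fun m => (hS m).const_mul (1 / 16 * ω ^ 2 - 1 / 4 * k ^ 2 : ℂ)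
  have := (((((((((hc (n + 4)).add ((h1 n).mul (hS (n + 3)))).add ((h2 n).mul (hS (n + 2)))).add
    ((h3 n).mul (hS (n + 1)))).add (h4.mul (hS n))).add ((h3 (-n)).mul (hS (n - 1)))).add
    ((h2 (-n)).mul (hS (n - 2)))).add ((h1 (-n)).mul (hS (n - 3)))).add (hc (n - 4)))
  convert! this using 1
  simp only [nineTerm, logRhs2]
  push_cast
  ring

/-- Only the coefficients at n and n ± 2 contain α; they yield the terms 2M(n±2) and −4M(n) of the
third right-hand side. -/
theorem hasDerivAt_logRhs2_left (k : ℝ) {α β : ℝ} {S : ℝ → ℤ → ℂ} {S' : ℤ → ℂ}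
    (hS : ∀ m, HasDerivAt (fun a => S a m) (S' m) α) (n : ℤ) :
    HasDerivAt (fun a => logRhs2 k a β (S a) n)
      (logRhs2 k α β S' n - (2 * S α (n + 2) - 4 * S α n + 2 * S α (n - 2))) α := by
  have lin : ∀ c₀ c₁ : ℂ, HasDerivAt (fun a : ℝ => c₀ + c₁ * a) (c₁ + 2 * 0 * α) α := fun c₀ c₁ =>
    hasDerivAt_of_eq_quadratic (fun a => by ring) α
  have := (((((((((hS (n + 3)).const_mul (Complex.I * k)).add
    ((lin (6 + 2 * β + 2 * n + 2 * Complex.I * k) 2).mul (hS (n + 2)))).add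
    ((hS (n + 1)).const_mul (12 - Complex.I * k + 4 * n + 8 * β))).add
    ((lin (12 - 4 * Complex.I * k + 12 * β) (-4)).mul (hS n))).add
    ((hS (n - 1)).const_mul (12 - Complex.I * k - 4 * n + 8 * β))).add
    ((lin (6 + 2 * β - 2 * n + 2 * Complex.I * k) 2).mul (hS (n - 2)))).add
    ((hS (n - 3)).const_mul (Complex.I * k)))).neg
  refine (this.congr_of_eventuallyEq (Eventually.of_forall fun a => ?_)).congr_deriv ?_
  · simp only [logRhs2, Pi.neg_apply, Pi.add_apply, Pi.mul_apply]
    ring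
  · simp only [logRhs2]
    ring

/-- The admissible α form an open set, so the homogeneous recurrence holds near α and its derivative
there is 0. -/
theorem nineTerm_logMoment1 {ν ω α β : ℝ} (k : ℝ) (hα : |ν| - 1 < α) (hβ : -1 < β) (hω : 0 < ω)
    (n : ℤ) :
    nineTerm ν k ω α β (logMoment1 ν k ω α β) n = logRhs1 k α β (moment ν k ω α β) n := by
  have h := hasDerivAt_nineTerm_left ν k ω (β := β) (S := fun a => moment ν k ω a β)
    (fun m => (logMoment1_spec k hα hβ hω m).2) n
  have h0 : HasDerivAt (fun a => nineTerm ν k ω a β (moment ν k ω a β) n) 0 α :=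
    (hasDerivAt_const α (0 : ℂ)).congr_of_eventuallyEq
      (by filter_upwards [lt_mem_nhds hα] with a ha using nineTerm_moment k ha hβ hω n)
  exact sub_eq_zero.1 (h.unique h0)

theorem nineTerm_logMoment2 {ν ω α β : ℝ} (k : ℝ) (hα : |ν| - 1 < α) (hβ : -1 < β) (hω : 0 < ω)
    (n : ℤ) :
    nineTerm ν k ω α β (logMoment2 ν k ω α β) n = logRhs2 k α β (moment ν k ω α β) n := by
  have h := hasDerivAt_nineTerm_right ν k ω (α := α) (S := fun b => moment ν k ω α b)
    (fun m => (logMoment2_spec k hα hβ hω m).2) n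
  have h0 : HasDerivAt (fun b => nineTerm ν k ω α b (moment ν k ω α b) n) 0 β :=
    (hasDerivAt_const β (0 : ℂ)).congr_of_eventuallyEq
      (by filter_upwards [lt_mem_nhds hβ] with b hb using nineTerm_moment k hα hb hω n)
  exact sub_eq_zero.1 (h.unique h0)

/-- The recurrence with factor ln(1−x) holds for all nearby α, so both its sides may be
differentiated in α. -/
theorem nineTerm_logMoment3 {ν ω α β : ℝ} (k : ℝ) (hα : |ν| - 1 < α) (hβ : -1 < β) (hω : 0 < ω)
    (n : ℤ) :
    nineTerm ν k ω α β (logMoment3 ν k ω α β) n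
      = logRhs3 k α β (moment ν k ω α β) (logMoment1 ν k ω α β) (logMoment2 ν k ω α β) n := by
  have h := hasDerivAt_nineTerm_left ν k ω (β := β) (S := fun a => logMoment2 ν k ω a β)
    (fun m => (logMoment3_spec_left k hα hβ hω m).2) n
  have h0 := hasDerivAt_logRhs2_left k (β := β) (S := fun a => moment ν k ω a β)
    (fun m => (logMoment1_spec k hα hβ hω m).2) n
  have h1 := h.unique (h0.congr_of_eventuallyEq
    (by filter_upwards [lt_mem_nhds hα] with a ha using nineTerm_logMoment2 k ha hβ hω n))
  rw [sub_eq_iff_eq_add.1 h1]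
  simp only [logRhs1, logRhs2, logRhs3]
  ring

end
-- Assembly of the main theorem
theorem mainTheorem2 (ν k ω α β : ℝ) (hα : -1 < α - |ν|) (hβ : -1 < β)
    (hk : 0 ≤ k) (hω : 0 < ω) :
    -- all four integrals converge absolutely
    (∀ n : ℤ,
      IntervalIntegrable (fun x : ℝ => momentIntegrand ν k ω α β n x)
        MeasureTheory.volume 0 1 ∧
      IntervalIntegrable (fun x : ℝ => (Real.log x : ℂ) * momentIntegrand ν k ω α β n x)
        MeasureTheory.volume 0 1 ∧
      IntervalIntegrable (fun x : ℝ => (Real.log (1 - x) : ℂ) * momentIntegrand ν k ω α β n x)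
        MeasureTheory.volume 0 1 ∧
      IntervalIntegrable
        (fun x : ℝ =>
          (Real.log x : ℂ) * (Real.log (1 - x) : ℂ) * momentIntegrand ν k ω α β n x)
        MeasureTheory.volume 0 1) ∧
    -- the logarithmic moments are the partial derivatives of the moment
    (∀ n : ℤ,
      HasDerivAt (fun a : ℝ => moment ν k ω a β n) (logMoment1 ν k ω α β n) α ∧
      HasDerivAt (fun b : ℝ => moment ν k ω α b n) (logMoment2 ν k ω α β n) β ∧
      HasDerivAt (fun a : ℝ => deriv (fun b : ℝ => moment ν k ω a b n) β)
        (logMoment3 ν k ω α β n) α ∧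
      HasDerivAt (fun b : ℝ => deriv (fun a : ℝ => moment ν k ω a b n) α)
        (logMoment3 ν k ω α β n) β) ∧
    -- the recurrences
    (∀ n : ℤ, 4 ≤ n →
      nineTerm ν k ω α β (logMoment1 ν k ω α β) n
        = logRhs1 k α β (moment ν k ω α β) n ∧
      nineTerm ν k ω α β (logMoment2 ν k ω α β) n
        = logRhs2 k α β (moment ν k ω α β) n ∧
      nineTerm ν k ω α β (logMoment3 ν k ω α β) n
        = logRhs3 k α β (moment ν k ω α β) (logMoment1 ν k ω α β)
            (logMoment2 ν k ω α β) n) := by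
  have hα' : |ν| - 1 < α := by linarith
  refine ⟨fun n => ⟨intervalIntegrable_momentIntegrand k hα' hβ hω n,
    (logMoment1_spec k hα' hβ hω n).1, (logMoment2_spec k hα' hβ hω n).1,
    (logMoment3_spec_left k hα' hβ hω n).1⟩,
    fun n => ⟨(logMoment1_spec k hα' hβ hω n).2, (logMoment2_spec k hα' hβ hω n).2,
      (logMoment3_spec_left k hα' hβ hω n).2.congr_of_eventuallyEq ?_,
      (logMoment3_spec_right k hα' hβ hω n).congr_of_eventuallyEq ?_⟩,
    fun n _ => ⟨nineTerm_logMoment1 k hα' hβ hω n, nineTerm_logMoment2 k hα' hβ hω n,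
      nineTerm_logMoment3 k hα' hβ hω n⟩⟩
  -- The inner `deriv` equals a logarithmic moment only at admissible exponents, which suffices
  -- because these fill a neighbourhood.
  · filter_upwards [lt_mem_nhds hα'] with a ha using (logMoment2_spec k ha hβ hω n).2.deriv
  · filter_upwards [lt_mem_nhds hβ] with b hb using (logMoment1_spec k hα' hb hω n).2.deriv
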